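/- Let $D$ be an integral domain with quotient field $K$ and let $\star$ be a semistar operation on $D$, i.e. a map $E\mapsto E^\star$ on the set of nonzero $D$-submodules of $K$ such that, for all nonzero $x\in K$ and all nonzero $D$-submodules $E,F$ of $K$: $(xE)^\star=xE^\star$; $E\subseteq F$ implies $E^\star\subseteq F^\star$; $E\subseteq E^\star$ and $(E^\star)^\star=E^\star$. Let $E^{\star_f}$ be the union of the $F^\star$ over all nonzero finitely generated $D$-submodules $F\subseteq E$. A quasi-$\star$-ideal of $D$ is a nonzero ideal $I$ of $D$ with $I^\star\cap D=I$; $\operatorname{QSpec}^\star(D)$ is the set of prime quasi-$\star$-ideals (quasi-$\star$-primes), and $\operatorname{QMax}^\star(D)$ the set of maximal elements of the set of proper quasi-$\star$-ideals (they are prime). Let $\widetilde\star$ be the semistar operation $E^{\widetilde\star}:=\bigcap\{ED_P\mid P\in\operatorname{QMax}^{\star_f}(D)\}$ (which is $K$ if $\operatorname{QMax}^{\star_f}(D)=\emptyset$). The domain $D$ is $\star$-Noetherian if it satisfies the ascending chain condition on quasi-$\star$-ideals. It is $\star$-quasi-Prüfer if, whenever $Q$ is a prime ideal of $D[X]$ with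 $Q\subseteq P[X]$ for some $P\in\operatorname{QSpec}^\star(D)$, one has $Q=(Q\cap D)[X]$. The semistar operation $\star[X]$ on $D[X]$ is $E^{\star[X]}:=E[Y]_{\mathfrak S}\cap K(X)$, where $\mathfrak S:=D[X][Y]\setminus\bigcup\{Q[Y]\mid Q\in\Theta\}$ and $\Theta$ is the set of prime ideals $Q$ of $D[X]$ with $Q\cap D=(0)$ or $(Q\cap D)^{\star_f}\subsetneq D^\star$. Put $D[n]:=D[X_1,\dots,X_n]$, $\star[1]:=\star[X_1]$ and $\star[n]:=(\star[n-1])[X_n]$ for $n\ge2$. The domain $D$ is a $\star$-strong S-domain if for every pair $P_1\subsetneq P_2$ of adjacent elements of $\operatorname{QSpec}^\star(D)\cup\{(0)\}$ (that is, with no element of this set strictly between them), $P_1[X]\subsetneq P_2[X]$ are adjacent elements of $\operatorname{QSpec}^{\star[X]}(D[X])\cup\{(0)\}$. It is a $\star$-stably strong S-domain if $D[n]$ is a $\star[n]$-strong S-domain for each $n\ge1$. **Corollary.** If $D$ is $\widetilde\star$-Noetherian, then $D$ is a $\widetilde\star$-stably strong S-domain. If $D$ is $\widetilde\star$-quasi-Prüfer,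 then $D$ is a $\widetilde\star$-stably strong S-domain. -/

import Mathlib

open Polynomial
open scoped Pointwise

universe u v

/-- A semistar operation on a domain `D` with quotient field `K`: a map on the nonzero
`D`-submodules of `K`.  It is presented as a total map on `Submodule D K` whose value at the zero
module is unconstrained and never used; the three axioms concern nonzero submodules only. -/
structure SemistarOperation (D : Type u) (K : Type v) [CommRing D] [Field K] [Algebra D K] where
  /-- The underlying map `E ↦ E^⋆`. -/
  toFun : Submodule D K → Submodule D K
  smul_eq : ∀ (x : K) (E : Submodule D K), x ≠ 0 → E ≠ ⊥ → toFun (x • E) = x • toFun E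
  mono : ∀ E F : Submodule D K, E ≠ ⊥ → E ≤ F → toFun E ≤ toFun F
  le_self : ∀ E : Submodule D K, E ≠ ⊥ → E ≤ toFun E
  idem : ∀ E : Submodule D K, E ≠ ⊥ → toFun (toFun E) = toFun E

namespace SemistarOperation

instance instCoeFun {D : Type u} {K : Type v} [CommRing D] [Field K] [Algebra D K] :
    CoeFun (SemistarOperation D K) fun _ => Submodule D K → Submodule D K :=
  ⟨toFun⟩

section Basic

variable {D : Type u} {K : Type v} [CommRing D] [Field K] [Algebra D K]

theorem ne_bot_of_le {E F : Submodule D K} (hE : E ≠ ⊥) (h : E ≤ F) : F ≠ ⊥ :=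
  fun hF => hE (le_bot_iff.mp (hF ▸ h))

theorem smul_ne_bot {E : Submodule D K} {x : K} (hx : x ≠ 0) (hE : E ≠ ⊥) : x • E ≠ ⊥ := by
  obtain ⟨e, he, he0⟩ := (Submodule.ne_bot_iff E).mp hE
  exact (Submodule.ne_bot_iff _).mpr
    ⟨x • e, Submodule.smul_mem_pointwise_smul e x E he, smul_ne_zero hx he0⟩

/-- To check `(xE)^⋆ = x E^⋆` for all nonzero `x`, one inclusion is enough. -/
theorem smul_eq_of_le {f : Submodule D K → Submodule D K}
    (h : ∀ (x : K) (E : Submodule D K), x ≠ 0 → E ≠ ⊥ → x • f E ≤ f (x • E))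
    (x : K) (E : Submodule D K) (hx : x ≠ 0) (hE : E ≠ ⊥) : f (x • E) = x • f E := by
  refine le_antisymm ?_ (h x E hx hE)
  have h1 := h x⁻¹ (x • E) (inv_ne_zero hx) (smul_ne_bot hx hE)
  rw [smul_smul, inv_mul_cancel₀ hx, one_smul] at h1
  intro y hy
  rw [Submodule.mem_smul_pointwise_iff_exists]
  refine ⟨x⁻¹ • y, h1 (Submodule.smul_mem_pointwise_smul y _ _ hy), ?_⟩
  rw [smul_smul, mul_inv_cancel₀ hx, one_smul]

/-! ### The semistar operation of finite type `⋆_f` -/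

/-- The nonzero finitely generated fractional ideals contained in `E` (a finitely generated
`D`-submodule of the quotient field is automatically fractional). -/
def fgBelow (E : Submodule D K) : Set (Submodule D K) :=
  {F | F.FG ∧ F ≠ ⊥ ∧ F ≤ E}

theorem fgBelow_nonempty {E : Submodule D K} (hE : E ≠ ⊥) : (fgBelow E).Nonempty := by
  obtain ⟨e, he, he0⟩ := (Submodule.ne_bot_iff E).mp hE
  refine ⟨Submodule.span D {e}, Submodule.fg_span_singleton e, ?_, ?_⟩
  · simpa using he0
  · simpa using he

theorem directedOn_fgBelow (star : SemistarOperation D K) (E : Submodule D K) :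
    DirectedOn (· ≤ ·) (star '' fgBelow E) := by
  rintro _ ⟨F, hF, rfl⟩ _ ⟨G, hG, rfl⟩
  have hFG : F ⊔ G ≠ ⊥ := ne_bot_of_le hF.2.1 le_sup_left
  exact ⟨star (F ⊔ G), ⟨F ⊔ G, ⟨hF.1.sup hG.1, hFG, sup_le hF.2.2 hG.2.2⟩, rfl⟩,
    star.mono _ _ hF.2.1 le_sup_left, star.mono _ _ hG.2.1 le_sup_right⟩

/-- For nonzero `E`, the supremum of the `F^⋆` is their union. -/
theorem mem_sSup_fgBelow (star : SemistarOperation D K) {E : Submodule D K} (hE : E ≠ ⊥) {x : K} :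
    x ∈ sSup (star '' fgBelow E) ↔ ∃ F, F.FG ∧ F ≠ ⊥ ∧ F ≤ E ∧ x ∈ star F := by
  rw [Submodule.mem_sSup_of_directed ((fgBelow_nonempty hE).image _) (directedOn_fgBelow star E)]
  constructor
  · rintro ⟨_, ⟨F, hF, rfl⟩, hx⟩
    exact ⟨F, hF.1, hF.2.1, hF.2.2, hx⟩
  · rintro ⟨F, h1, h2, h3, hx⟩
    exact ⟨_, ⟨F, ⟨h1, h2, h3⟩, rfl⟩, hx⟩

theorem le_sSup_fgBelow (star : SemistarOperation D K) {E : Submodule D K} (hE : E ≠ ⊥) :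
    E ≤ sSup (star '' fgBelow E) := by
  intro e he
  rw [mem_sSup_fgBelow star hE]
  obtain ⟨F, hF1, hF2, hF3⟩ := fgBelow_nonempty hE
  have h2 : F ⊔ Submodule.span D {e} ≠ ⊥ := ne_bot_of_le hF2 le_sup_left
  refine ⟨F ⊔ Submodule.span D {e}, hF1.sup (Submodule.fg_span_singleton e), h2,
    sup_le hF3 (by simpa using he), star.le_self _ h2 ?_⟩
  exact (le_sup_right : Submodule.span D {e} ≤ _) (Submodule.mem_span_singleton_self e)

/-- The semistar operation of finite type `⋆_f` associated to `⋆`: `E^{⋆_f}` is the union of the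
`F^⋆`, where `F` runs over the nonzero finitely generated `F ⊆ E` (see `mem_finiteType`). -/
def finiteType (star : SemistarOperation D K) : SemistarOperation D K where
  toFun E := sSup (star '' fgBelow E)
  smul_eq := by
    refine smul_eq_of_le (f := fun E => sSup (star.toFun '' fgBelow E)) ?_
    intro x E hx hE y hy
    rw [Submodule.mem_smul_pointwise_iff_exists] at hy
    obtain ⟨z, hz, rfl⟩ := hy
    obtain ⟨F, h1, h2, h3, hz⟩ := (mem_sSup_fgBelow star hE).mp hz
    refine (mem_sSup_fgBelow star (smul_ne_bot hx hE)).mpr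
      ⟨x • F, ?_, smul_ne_bot hx h2, smul_mono_right x h3, ?_⟩
    · exact h1.map _
    · rw [star.smul_eq x F hx h2]
      exact Submodule.smul_mem_pointwise_smul z x _ hz
  mono E F _ hEF :=
    sSup_le_sSup (Set.image_mono fun _ hG => ⟨hG.1, hG.2.1, hG.2.2.trans hEF⟩)
  le_self E hE := le_sSup_fgBelow star hE
  idem E hE := by
    have hE' := ne_bot_of_le hE (le_sSup_fgBelow star hE)
    refine le_antisymm ?_ (le_sSup_fgBelow star hE')
    intro x hx
    obtain ⟨F, h1, h2, h3, hx⟩ := (mem_sSup_fgBelow star hE').mp hx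
    obtain ⟨_, ⟨G, hG, rfl⟩, hFG⟩ :=
      (CompleteLattice.isCompactElement_iff_le_of_directed_sSup_le _ F).mp
        ((Submodule.fg_iff_compact F).mp h1) _ ((fgBelow_nonempty hE).image _)
        (directedOn_fgBelow star E) h3
    refine (mem_sSup_fgBelow star hE).mpr ⟨G, hG.1, hG.2.1, hG.2.2, ?_⟩
    rw [← star.idem G hG.2.1]
    exact star.mono _ _ h2 hFG hx

theorem mem_finiteType (star : SemistarOperation D K) {E : Submodule D K} (hE : E ≠ ⊥) {x : K} :
    x ∈ star.finiteType E ↔ ∃ F, F.FG ∧ F ≠ ⊥ ∧ F ≤ E ∧ x ∈ star F :=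
  mem_sSup_fgBelow star hE

/-! ### Quasi-`⋆`-ideals -/

/-- A quasi-`⋆`-ideal: a nonzero ideal `I` of `D` with `I^⋆ ∩ D = I`. -/
def IsQuasiIdeal (star : SemistarOperation D K) (I : Ideal D) : Prop :=
  I ≠ ⊥ ∧ (star (IsLocalization.coeSubmodule K I)).comap (Algebra.linearMap D K) = I

/-- A quasi-`⋆`-prime ideal, i.e. an element of `QSpec^⋆(D)`; in particular it is nonzero. -/
def IsQuasiPrime (star : SemistarOperation D K) (P : Ideal D) : Prop :=
  P.IsPrime ∧ star.IsQuasiIdeal P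

/-- A quasi-`⋆`-maximal ideal, i.e. an element of `QMax^⋆(D)`: a maximal element of the set of
proper quasi-`⋆`-ideals. -/
def IsQuasiMaximal (star : SemistarOperation D K) (M : Ideal D) : Prop :=
  Maximal (fun I : Ideal D => I ≠ ⊤ ∧ star.IsQuasiIdeal I) M

/-! ### Spectral semistar operations and `⋆̃` -/

/-- `E D_P`, the `D`-submodule `{e / s : e ∈ E, s ∈ D \ P}` of `K`. -/
def localize (E : Submodule D K) (P : PrimeSpectrum D) : Submodule D K where
  carrier := {x | ∃ s : D, s ∉ P.asIdeal ∧ s • x ∈ E}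
  zero_mem' := ⟨1, (Ideal.ne_top_iff_one _).mp P.isPrime.ne_top, by simp⟩
  add_mem' := by
    rintro x y ⟨s, hs, hx⟩ ⟨t, ht, hy⟩
    refine ⟨s * t, fun h => (P.isPrime.mem_or_mem h).elim hs ht, ?_⟩
    rw [smul_add]
    refine E.add_mem ?_ ?_
    · rw [mul_comm, mul_smul]
      exact E.smul_mem t hx
    · rw [mul_smul]
      exact E.smul_mem s hy
  smul_mem' := by
    rintro c x ⟨s, hs, hx⟩
    exact ⟨s, hs, by rw [smul_comm]; exact E.smul_mem c hx⟩

theorem le_localize (E : Submodule D K) (P : PrimeSpectrum D) : E ≤ localize E P :=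
  fun x hx => ⟨1, (Ideal.ne_top_iff_one _).mp P.isPrime.ne_top, by simpa using hx⟩

theorem localize_mono {E F : Submodule D K} (h : E ≤ F) (P : PrimeSpectrum D) :
    localize E P ≤ localize F P :=
  fun _ ⟨s, hs, hx⟩ => ⟨s, hs, h hx⟩

/-- The spectral semistar operation `⋆_Δ` associated to a set `Δ` of primes of `D`:
`E^{⋆_Δ} = ⋂ {E D_P | P ∈ Δ}`, which is `K` if `Δ` is empty. -/
def spectral (Δ : Set (PrimeSpectrum D)) : SemistarOperation D K where
  toFun E := ⨅ P ∈ Δ, localize E P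
  smul_eq := by
    refine smul_eq_of_le (f := fun E => ⨅ P ∈ Δ, localize E P) ?_
    intro x E hx hE y hy
    rw [Submodule.mem_smul_pointwise_iff_exists] at hy
    obtain ⟨z, hz, rfl⟩ := hy
    simp only [Submodule.mem_iInf] at hz ⊢
    intro P hP
    obtain ⟨s, hs, h⟩ := hz P hP
    refine ⟨s, hs, ?_⟩
    rw [smul_comm]
    exact Submodule.smul_mem_pointwise_smul _ _ _ h
  mono E F _ h := iInf₂_mono fun P _ => localize_mono h P
  le_self E _ := le_iInf₂ fun P _ => le_localize E P
  idem E _ := by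
    refine le_antisymm (iInf₂_mono fun P hP => ?_) (le_iInf₂ fun P _ => le_localize _ P)
    rintro x ⟨s, hs, hx⟩
    obtain ⟨t, ht, htx⟩ := (iInf₂_le P hP : (⨅ P ∈ Δ, localize E P) ≤ _) hx
    exact ⟨t * s, fun h => (P.isPrime.mem_or_mem h).elim ht hs, by rwa [mul_smul]⟩

/-- The operation `⋆̃`: the spectral semistar operation associated to `QMax^{⋆_f}(D)`.
(Quasi-`⋆_f`-maximal ideals are prime, so all of them occur here:
see `IsQuasiMaximal.isPrime`.) -/
def tilde (star : SemistarOperation D K) : SemistarOperation D K :=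
  spectral {P | star.finiteType.IsQuasiMaximal P.asIdeal}

/-! ### Properties of a domain relative to a semistar operation -/

/-- `D` is `⋆`-Noetherian: the ascending chain condition on quasi-`⋆`-ideals. -/
def IsNoetherianDomain (star : SemistarOperation D K) : Prop :=
  WellFoundedGT {I : Ideal D // star.IsQuasiIdeal I}

/-- `D` is `⋆`-quasi-Prüfer: every prime `Q` of `D[X]` with `Q ⊆ P[X]` for some
`P ∈ QSpec^⋆(D)` satisfies `Q = (Q ∩ D)[X]`. -/
def IsQuasiPruferDomain (star : SemistarOperation D K) : Prop :=
  ∀ Q : Ideal D[X], Q.IsPrime → ∀ P : Ideal D, star.IsQuasiPrime P →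
    Q ≤ P.map (C : D →+* D[X]) →
      Q = (Q.comap (C : D →+* D[X])).map (C : D →+* D[X])

/-- `P₁ ⊂ P₂` are adjacent elements of `QSpec^⋆(D) ∪ {0}`. -/
structure IsAdjacent (star : SemistarOperation D K) (P₁ P₂ : Ideal D) : Prop where
  left : P₁ = ⊥ ∨ star.IsQuasiPrime P₁
  right : star.IsQuasiPrime P₂
  lt : P₁ < P₂
  not_between : ∀ Q : Ideal D, star.IsQuasiPrime Q → P₁ < Q → ¬ Q < P₂

/-! ### The semistar operation `⋆[X]` on `D[X]` -/

/-- `Θ₁^⋆`, the set of primes `Q` of `D[X]` with `Q ∩ D = 0` or `(Q ∩ D)^{⋆_f} ⊊ D^⋆`. -/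
def theta (star : SemistarOperation D K) : Set (PrimeSpectrum D[X]) :=
  {Q | Q.asIdeal.comap (C : D →+* D[X]) = ⊥ ∨
    star.finiteType (IsLocalization.coeSubmodule K (Q.asIdeal.comap (C : D →+* D[X]))) <
      star (IsLocalization.coeSubmodule K ⊤)}

/-- The multiplicative set `D[X][Y] \ ⋃ {Q[Y] | Q ∈ Θ₁^⋆}`. -/
def thetaCompl (star : SemistarOperation D K) : Submonoid D[X][X] where
  carrier := {s | ∀ Q ∈ star.theta, s ∉ Q.asIdeal.map (C : D[X] →+* D[X][X])}
  one_mem' Q _ :=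
    (Ideal.ne_top_iff_one _).mp (Ideal.isPrime_map_C_of_isPrime (P := Q.asIdeal)).ne_top
  mul_mem' hs ht Q hQ h :=
    ((Ideal.isPrime_map_C_of_isPrime (P := Q.asIdeal)).mem_or_mem h).elim (hs Q hQ) (ht Q hQ)

end Basic

/-- For a domain `A`, a multiplicative set `S ⊆ A[Y] \ {0}` and an `A`-submodule `E` of the
quotient field `L` of `A`, the `A`-module `E[Y]_S ∩ L`: an element `x` of `L` has the form `f / s`
with `f ∈ E[Y]` and `s ∈ S` iff some `s ∈ S` has `x s ∈ E[Y]`, that is, all coefficients of the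
polynomial `x s ∈ L[Y]` lie in `E`. -/
def nagata {A : Type u} {L : Type v} [CommRing A] [Field L] [Algebra A L]
    (S : Submonoid A[X]) (E : Submodule A L) : Submodule A L where
  carrier := {x | ∃ s ∈ S, ∀ i, (C x * s.map (algebraMap A L)).coeff i ∈ E}
  zero_mem' := ⟨1, S.one_mem, by simp⟩
  add_mem' := by
    rintro x y ⟨s, hs, hx⟩ ⟨t, ht, hy⟩
    refine ⟨s * t, S.mul_mem hs ht, fun i => ?_⟩
    have h1 : C (x + y) * (s * t).map (algebraMap A L) =
        C x * s.map (algebraMap A L) * t.map (algebraMap A L) +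
          C y * t.map (algebraMap A L) * s.map (algebraMap A L) := by
      rw [Polynomial.map_mul, C_add]; ring
    rw [h1, coeff_add, coeff_mul, coeff_mul]
    refine E.add_mem (E.sum_mem fun p _ => ?_) (E.sum_mem fun p _ => ?_)
    · rw [coeff_map, mul_comm, ← Algebra.smul_def]
      exact E.smul_mem _ (hx _)
    · rw [coeff_map (n := p.2), mul_comm, ← Algebra.smul_def]
      exact E.smul_mem _ (hy _)
  smul_mem' := by
    rintro c x ⟨s, hs, hx⟩
    refine ⟨s, hs, fun i => ?_⟩
    have := E.smul_mem c (hx i)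
    rw [coeff_C_mul] at this ⊢
    rwa [smul_mul_assoc]

theorem mem_nagata {A : Type u} {L : Type v} [CommRing A] [Field L] [Algebra A L]
    {S : Submonoid A[X]} {E : Submodule A L} {x : L} :
    x ∈ nagata S E ↔ ∃ s ∈ S, ∀ i, s.coeff i • x ∈ E := by
  refine exists_congr fun s => and_congr_right fun _ => forall_congr' fun i => ?_
  rw [coeff_C_mul, coeff_map, mul_comm, ← Algebra.smul_def]

theorem le_nagata {A : Type u} {L : Type v} [CommRing A] [Field L] [Algebra A L]
    (S : Submonoid A[X]) (E : Submodule A L) : E ≤ nagata S E := by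
  intro x hx
  exact mem_nagata.mpr ⟨1, S.one_mem, fun i => E.smul_mem _ hx⟩

theorem nagata_nagata_le {A : Type u} {L : Type v} [CommRing A] [Field L] [Algebra A L]
    (S : Submonoid A[X]) (E : Submodule A L) : nagata S (nagata S E) ≤ nagata S E := by
  intro x hx
  obtain ⟨s, hs, hx⟩ := mem_nagata.mp hx
  choose t ht htx using fun i => mem_nagata.mp (hx i)
  -- one denominator for finitely many coefficients of `s`
  have key : ∀ J : Finset ℕ, ∃ r ∈ S, ∀ i ∈ J, ∀ j, r.coeff j • s.coeff i • x ∈ E := by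
    intro J
    induction J using Finset.induction_on with
    | empty => exact ⟨1, S.one_mem, by simp⟩
    | insert a J _ ih =>
      obtain ⟨r, hr, h⟩ := ih
      refine ⟨t a * r, S.mul_mem (ht a) hr, fun i hi j => ?_⟩
      rw [coeff_mul, Finset.sum_smul]
      refine E.sum_mem fun p _ => ?_
      rcases Finset.mem_insert.mp hi with rfl | hi
      · rw [mul_comm, mul_smul]
        exact E.smul_mem _ (htx _ _)
      · rw [mul_smul]
        exact E.smul_mem _ (h i hi _)
  obtain ⟨r, hr, h⟩ := key s.support
  refine mem_nagata.mpr ⟨r * s, S.mul_mem hr hs, fun i => ?_⟩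
  rw [coeff_mul, Finset.sum_smul]
  refine E.sum_mem fun p _ => ?_
  rw [mul_smul]
  by_cases hp : p.2 ∈ s.support
  · exact h _ hp _
  · simp [notMem_support_iff.mp hp]

section Polynomial

variable {D : Type u} {K : Type v} [CommRing D] [Field K] [Algebra D K]

/-- The semistar operation `⋆[X]` on `D[X]`: with `S = D[X][Y] \ ⋃ {Q[Y] | Q ∈ Θ₁^⋆}` and `K₁` the
quotient field of `D[X]`, it is the map `E ↦ E[Y]_S ∩ K₁`. -/
noncomputable def polynomial (star : SemistarOperation D K) (K₁ : Type u) [Field K₁] [Algebra D[X] K₁] :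
    SemistarOperation D[X] K₁ where
  toFun E := nagata star.thetaCompl E
  smul_eq := by
    refine smul_eq_of_le (f := fun E => nagata star.thetaCompl E) ?_
    intro x E hx hE y hy
    rw [Submodule.mem_smul_pointwise_iff_exists] at hy
    obtain ⟨z, hz, rfl⟩ := hy
    obtain ⟨s, hs, h⟩ := mem_nagata.mp hz
    refine mem_nagata.mpr ⟨s, hs, fun i => ?_⟩
    rw [smul_comm]
    exact Submodule.smul_mem_pointwise_smul _ _ _ (h i)
  mono E F _ h x := fun ⟨s, hs, hx⟩ => ⟨s, hs, fun i => h (hx i)⟩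
  le_self E _ := le_nagata _ E
  idem E _ := le_antisymm (nagata_nagata_le _ E) (le_nagata _ _)

/-- `D` is a `⋆`-strong S-domain: each pair of adjacent elements `P₁ ⊂ P₂` of `QSpec^⋆(D) ∪ {0}`
extends to a pair of adjacent elements `P₁[X] ⊂ P₂[X]` of `QSpec^{⋆[X]}(D[X]) ∪ {0}`. -/
def IsStrongSDomain [IsDomain D] (star : SemistarOperation D K) : Prop :=
  ∀ P₁ P₂ : Ideal D, star.IsAdjacent P₁ P₂ →
    (star.polynomial (FractionRing D[X])).IsAdjacent
      (P₁.map (C : D →+* D[X])) (P₂.map (C : D →+* D[X]))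

end Polynomial

/-- `D[n] = D[X₁, …, X_n]` is a `⋆[n]`-strong S-domain.  Here `D[n]` and `⋆[n]` arise from `D` and
`⋆` by applying the construction `(D, ⋆) ↦ (D[X], ⋆[X])` `n` times. -/
def IsStrongSDomainAfter : (n : ℕ) → {D K : Type u} → [CommRing D] → [IsDomain D] → [Field K] →
    [Algebra D K] → SemistarOperation D K → Prop
  | 0, _, _, _, _, _, _, star => star.IsStrongSDomain
  | n + 1, D, _, _, _, _, _, star =>
      IsStrongSDomainAfter n (star.polynomial (FractionRing D[X]))

/-- `D` is a `⋆`-stably strong S-domain: `D[n]` is a `⋆[n]`-strong S-domain for each `n ≥ 1`. -/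
def IsStablyStrongSDomain {D K : Type u} [CommRing D] [IsDomain D] [Field K] [Algebra D K]
    (star : SemistarOperation D K) : Prop :=
  ∀ n : ℕ, 1 ≤ n → IsStrongSDomainAfter n star

/-- Quasi-`⋆`-maximal ideals are prime. -/
theorem IsQuasiMaximal.isPrime {D : Type u} {K : Type v} [CommRing D] [IsDomain D] [Field K]
    [Algebra D K] [IsFractionRing D K] {star : SemistarOperation D K} {M : Ideal D}
    (hM : star.IsQuasiMaximal M) : M.IsPrime := by
  obtain ⟨⟨hM1, hM0, hMq⟩, hmax⟩ := hM
  have hinj : Function.Injective (algebraMap D K) := IsFractionRing.injective D K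
  have hcoe : ∀ I : Ideal D, I ≠ ⊥ → IsLocalization.coeSubmodule K I ≠ ⊥ := by
    intro I hI
    obtain ⟨a, ha, ha0⟩ := (Submodule.ne_bot_iff I).mp hI
    exact (Submodule.ne_bot_iff _).mpr ⟨algebraMap D K a,
      (IsLocalization.mem_coeSubmodule K I).mpr ⟨a, ha, rfl⟩,
      fun h => ha0 (hinj (h.trans (map_zero _).symm))⟩
  refine ⟨hM1, fun {a b} hab => ?_⟩
  by_contra! hcon
  obtain ⟨ha, hb⟩ := hcon
  set I : Ideal D := M ⊔ Ideal.span {a} with hI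
  have hMI : M ≤ I := le_sup_left
  have hI0 : I ≠ ⊥ := fun h => hM0 (le_bot_iff.mp (h ▸ hMI))
  set J : Ideal D :=
    (star (IsLocalization.coeSubmodule K I)).comap (Algebra.linearMap D K) with hJ
  have hIJ : I ≤ J := fun y hy => star.le_self _ (hcoe I hI0)
    ((IsLocalization.mem_coeSubmodule K I).mpr ⟨y, hy, rfl⟩)
  have hJ0 : J ≠ ⊥ := fun h => hI0 (le_bot_iff.mp (h ▸ hIJ))
  have hJq : star.IsQuasiIdeal J := by
    refine ⟨hJ0, le_antisymm ?_ ?_⟩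
    · refine Submodule.comap_mono ?_
      rw [← star.idem _ (hcoe I hI0)]
      refine star.mono _ _ (hcoe J hJ0) ?_
      intro y hy
      obtain ⟨z, hz, rfl⟩ := (IsLocalization.mem_coeSubmodule K J).mp hy
      exact hz
    · intro y hy
      exact star.le_self _ (hcoe J hJ0) ((IsLocalization.mem_coeSubmodule K J).mpr ⟨y, hy, rfl⟩)
  have haI : a ∈ I := (le_sup_right : Ideal.span {a} ≤ I) (Ideal.mem_span_singleton_self a)
  have hJtop : J = ⊤ := by
    by_contra h
    exact ha (hmax ⟨h, hJq⟩ (hMI.trans hIJ) (hIJ haI))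
  have hone : (1 : K) ∈ star (IsLocalization.coeSubmodule K I) := by
    have : (1 : D) ∈ J := hJtop ▸ Submodule.mem_top
    simpa [hJ] using this
  have hb0 : algebraMap D K b ≠ 0 := by
    intro h
    have h' : b = 0 := hinj (h.trans (map_zero _).symm)
    exact hb (h' ▸ M.zero_mem)
  have hbmem : algebraMap D K b ∈ star (algebraMap D K b • IsLocalization.coeSubmodule K I) := by
    rw [star.smul_eq _ _ hb0 (hcoe I hI0)]
    have := Submodule.smul_mem_pointwise_smul (1 : K) (algebraMap D K b) _ hone
    simpa using this
  have hle : algebraMap D K b • IsLocalization.coeSubmodule K I ≤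
      IsLocalization.coeSubmodule K M := by
    intro y hy
    rw [Submodule.mem_smul_pointwise_iff_exists] at hy
    obtain ⟨z, hz, rfl⟩ := hy
    obtain ⟨c, hc, rfl⟩ := (IsLocalization.mem_coeSubmodule K I).mp hz
    refine (IsLocalization.mem_coeSubmodule K M).mpr ⟨b * c, ?_, by simp⟩
    obtain ⟨m, hm, d, hd, rfl⟩ := Submodule.mem_sup.mp hc
    obtain ⟨e, rfl⟩ := Ideal.mem_span_singleton'.mp hd
    have : b * (m + e * a) = b * m + e * (a * b) := by ring
    rw [this]
    exact M.add_mem (M.mul_mem_left b hm) (M.mul_mem_left e hab)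
  have := star.mono _ _ (smul_ne_bot hb0 (hcoe I hI0)) hle hbmem
  have hbM : b ∈ (star (IsLocalization.coeSubmodule K M)).comap (Algebra.linearMap D K) := this
  rw [hMq] at hbM
  exact hb hbM

end SemistarOperation

/-! Let `Δ` be the set `tildePrimes`. On integral ideals the operation `⋆̃` behaves like
localization at the primes in `Δ`, and each iterate `⋆̃[n]` does so for the primes of `D[n]`
contracting into `Δ` (`IsControlledBy`, `IsControlledBy.polynomial`). Since these sets are stable
under generization, adjacency among quasi-primes is ordinary adjacency of primes, and the theorem
becomes one about finite type `D`-algebras `A`.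

If `Q₁ ⊂ Q₂` are adjacent in `A`, a prime strictly between `Q₁[X]` and `Q₂[X]` contracts to `Q₁`;
modulo `Q₁` it is an upper to zero (a nonzero prime contracting to zero) below `N[X]`, where `N` has
height one. `NoUppersBelow` excludes it.

Noetherian case: `D_P` is Noetherian for `P ∈ Δ`, hence so is the localization at `N`, and Krull's
principal ideal theorem applies.

Quasi-Prüfer case (`NoUppersBelow.of_finiteType`): replace `D` by its image in `B = A ⧸ Q₁`, put `M
= N ∩ D`, and suppose `M ≠ 0`. Lift a transcendence basis of `B ⧸ N` over `D ⧸ M` to `y`. Zariski's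
main theorem makes `B` algebraic over `D[y]`, so modulo an upper `q` the class of `X` is algebraic
over `D[y]`. Yet `y, X` are independent modulo `N[X]`, and a valuation argument lifts this to
independence modulo `q` (`NoUppersBelow.algebraicIndependent`), a contradiction. -/

/-- No nonzero prime of `R[X]` contained in `P[X]` contracts to zero in `R`. -/
def NoUppersBelow {R : Type*} [CommRing R] (P : Ideal R) : Prop :=
  ∀ Q : Ideal R[X], Q.IsPrime → Q.comap (C : R →+* R[X]) = ⊥ →
    Q ≤ P.map (C : R →+* R[X]) → Q = ⊥

theorem Ideal.comap_C_map_C {R : Type*} [CommRing R] (I : Ideal R) :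
    (I.map (C : R →+* R[X])).comap (C : R →+* R[X]) = I := by
  refine le_antisymm (fun a ha => ?_) Ideal.le_comap_map
  have := Ideal.mem_map_C_iff.mp (Ideal.mem_comap.mp ha) 0
  rwa [coeff_C_zero] at this

/-! ### Lifting algebraic independence through valuation rings. -/

/-- Every prime of a domain is the centre of a valuation ring of the quotient field. -/
theorem exists_valuationSubring_dominating {E L : Type*} [CommRing E] [IsDomain E] [Field L]
    [Algebra E L] [IsFractionRing E L] (n : Ideal E) [n.IsPrime] :
    ∃ W : ValuationSubring L, (∀ e, algebraMap E L e ∈ W) ∧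
      ∀ e, W.valuation (algebraMap E L e) < 1 ↔ e ∈ n := by
  have hunit : ∀ s : n.primeCompl, IsUnit (algebraMap E L s) := fun s => by
    refine IsUnit.mk0 _ fun h => s.2 ?_
    have h0 : (s : E) = 0 := IsFractionRing.injective E L (h.trans (map_zero _).symm)
    rw [h0]
    exact n.zero_mem
  let f : Localization.AtPrime n →+* L := IsLocalization.lift hunit
  have hf : ∀ e, f (algebraMap E _ e) = algebraMap E L e := fun e => IsLocalization.lift_eq _ e
  -- Chevalley's theorem: `W` dominates the image of `E_n`. Containment keeps elements outside `n`
  -- units of `W`; locality makes those of `n` nonunits.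
  obtain ⟨W, hle, hloc⟩ := (LocalSubring.range f).exists_le_valuationSubring
  have hmem : ∀ x, f x ∈ W := fun x => hle ⟨x, rfl⟩
  refine ⟨W, fun e => hf e ▸ hmem _, fun e => ?_⟩
  constructor
  · intro hlt
    by_contra he
    obtain ⟨y, hy⟩ := (IsLocalization.map_units (Localization.AtPrime n)
      (⟨e, he⟩ : n.primeCompl)).exists_right_inv
    have h1 : algebraMap E L e * f y = 1 := by
      rw [← hf, ← map_mul]
      exact (congrArg f hy).trans (map_one f)
    have h2 := congrArg W.valuation h1
    rw [map_mul, map_one] at h2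
    exact absurd h2 (mul_lt_one_of_lt_of_le hlt ((W.valuation_le_one_iff _).mpr (hmem y))).ne
  · intro he
    have hW : algebraMap E L e ∈ W := hf e ▸ hmem _
    rw [show algebraMap E L e = ((⟨algebraMap E L e, hW⟩ : W) : L) from rfl,
      ← W.valuation_lt_one_iff, IsLocalRing.mem_maximalIdeal, mem_nonunits_iff]
    intro hu
    have hr : algebraMap E L e ∈ (LocalSubring.range f).toSubring := ⟨algebraMap E _ e, hf e⟩
    have hu' : IsUnit (⟨algebraMap E L e, hr⟩ : (LocalSubring.range f).toSubring) :=
      hloc.map_nonunit _ hu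
    obtain ⟨⟨y, x, rfl⟩, hy⟩ := hu'.exists_right_inv
    have h1 : f (algebraMap E _ e * x) = f 1 := by
      rw [map_mul, hf, map_one]
      exact congrArg Subtype.val hy
    have hfinj : Function.Injective f := by
      refine (IsLocalization.lift_injective_iff _).mpr fun a b => ?_
      rw [(IsFractionRing.injective E L).eq_iff,
        (IsLocalization.injective (Localization.AtPrime n)
          n.primeCompl_le_nonZeroDivisors).eq_iff]
    have h2 := IsUnit.of_mul_eq_one _ (hfinj h1)
    exact (IsLocalization.AtPrime.isUnit_to_map_iff (Localization.AtPrime n) n e).mp h2 he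

/-- If no uppers to zero lie below the contraction of a prime `n`, then elements that are
algebraically independent modulo `n` are algebraically independent. -/
theorem NoUppersBelow.algebraicIndependent {D E ι : Type*} [CommRing D] [IsDomain D] [CommRing E]
    [IsDomain E] [Algebra D E] (hinj : Function.Injective (algebraMap D E)) (n : Ideal E)
    [n.IsPrime] (hM : NoUppersBelow (n.under D)) (z : ι → E)
    (hz : AlgebraicIndependent (D ⧸ n.under D) (fun i => Ideal.Quotient.mk n (z i))) :
    AlgebraicIndependent D z := by
  classical
  obtain ⟨W, hW, hn⟩ := exists_valuationSubring_dominating (L := FractionRing E) n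
  let L := FractionRing E
  have hDL : Function.Injective (algebraMap D L) := by
    rw [IsScalarTower.algebraMap_eq D E L]
    exact (IsFractionRing.injective E L).comp hinj
  let k := IsLocalRing.ResidueField W
  let φ : E →+* W := (algebraMap E L).codRestrict W.toSubring hW
  let ψ : E →+* k := (IsLocalRing.residue W).comp φ
  have hψ : ∀ e, ψ e = 0 ↔ e ∈ n := fun e => by
    rw [← hn, show algebraMap E (FractionRing E) e = ((φ e : W) : L) from rfl,
      ← W.valuation_lt_one_iff]
    exact IsLocalRing.residue_eq_zero_iff _
  let g : E ⧸ n →+* k := Ideal.Quotient.lift n ψ fun a ha => (hψ a).mpr ha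
  have hg : Function.Injective g := by
    refine (injective_iff_map_eq_zero g).mpr fun a => ?_
    obtain ⟨a, rfl⟩ := Ideal.Quotient.mk_surjective a
    exact fun h => Ideal.Quotient.eq_zero_iff_mem.mpr ((hψ a).mp h)
  let : Algebra (D ⧸ n.under D) k := (g.comp (algebraMap (D ⧸ n.under D) (E ⧸ n))).toAlgebra
  let gA : E ⧸ n →ₐ[D ⧸ n.under D] k := ⟨g, fun r => rfl⟩
  have hz' : AlgebraicIndependent (D ⧸ n.under D) (fun i => ψ (z i)) := hz.map' (f := gA) hg
  -- the residues of elements of `W` that are quotients of elements of `D` are algebraic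
  have key : ∀ t : W, ∀ a b : D, b ≠ 0 → algebraMap D L b * t = algebraMap D L a →
      IsAlgebraic (D ⧸ n.under D) (IsLocalRing.residue W t) := by
    intro t a b hb hab
    by_contra htr
    -- For transcendental residue, every polynomial over `D` killing `t` has its coefficients in `n
    -- ∩ D`. So `hM` forces `Q = 0`, although `bX - a ∈ Q`.
    let Q : Ideal D[X] := RingHom.ker (aeval (R := D) (t : L))
    have hQ : Q = ⊥ := by
      refine hM Q (RingHom.ker_isPrime _) ?_ ?_
      · refine le_bot_iff.mp fun d hd => ?_
        have : aeval (t : L) (C d) = 0 := hd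
        rw [aeval_C] at this
        exact hDL (this.trans (map_zero _).symm)
      · intro p hp
        have hp : aeval (t : L) p = 0 := hp
        rw [Ideal.mem_map_C_iff]
        have h1 : p.eval₂ (φ.comp (algebraMap D E)) t = 0 := by
          apply Subtype.val_injective
          have : W.subtype (p.eval₂ (φ.comp (algebraMap D E)) t) =
              p.eval₂ (algebraMap D L) (t : L) := by
            rw [hom_eval₂]
            rfl
          exact this.trans hp
        have h2 : aeval (IsLocalRing.residue W t) (p.map (Ideal.Quotient.mk (n.under D))) = 0 := by
          rw [aeval_def, eval₂_map]
          have := congrArg (IsLocalRing.residue W) h1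
          rw [hom_eval₂, map_zero] at this
          exact this
        have h3 : p.map (Ideal.Quotient.mk (n.under D)) = 0 := by
          by_contra h0
          exact htr ⟨_, h0, h2⟩
        intro i
        have := congrArg (fun q => q.coeff i) h3
        simp only [coeff_map, coeff_zero] at this
        exact Ideal.Quotient.eq_zero_iff_mem.mp this
    have hlin : C b * X - C a ∈ Q := by
      change aeval (t : L) (C b * X - C a) = 0
      rw [map_sub, map_mul, aeval_C, aeval_X, aeval_C]
      exact sub_eq_zero.mpr hab
    rw [hQ, Ideal.mem_bot] at hlin
    have := congrArg (fun q => q.coeff 1) hlin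
    simp [coeff_C] at this
    exact hb this
  let A := Subalgebra.algebraicClosure (D ⧸ n.under D) k
  have hzA : AlgebraicIndependent A (fun i => ψ (z i)) := hz'.extendScalars A
  rw [algebraicIndependent_iff]
  intro p hp
  by_contra hp0
  -- Dividing the relation by a coefficient of maximal value puts all coefficients in `W`, the one
  -- at `m₀` being `1`. Its residue is a nontrivial relation over `A`, contradicting `hzA`.
  obtain ⟨m₀, hm₀, hmax⟩ := p.support.exists_max_image
    (fun m => W.valuation (algebraMap D L (p.coeff m))) (MvPolynomial.support_nonempty.mpr hp0)
  set c := p.coeff m₀ with hc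
  have hc0 : c ≠ 0 := MvPolynomial.mem_support_iff.mp hm₀
  have hcL : algebraMap D L c ≠ 0 := fun h => hc0 (hDL (h.trans (map_zero _).symm))
  have hcoef : ∀ m, algebraMap D L (p.coeff m) / algebraMap D L c ∈ W := by
    intro m
    by_cases hm : m ∈ p.support
    · rw [← W.valuation_le_one_iff, map_div₀]
      exact div_le_one_of_le₀ (hmax m hm) zero_le
    · rw [MvPolynomial.notMem_support_iff.mp hm, map_zero, zero_div]
      exact W.zero_mem
  let w : (ι →₀ ℕ) → W := fun m => ⟨_, hcoef m⟩
  have hwalg : ∀ m, IsLocalRing.residue W (w m) ∈ A := fun m =>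
    key (w m) (p.coeff m) c hc0 (mul_div_cancel₀ _ hcL)
  let P : MvPolynomial ι A := ∑ m ∈ p.support, MvPolynomial.monomial m ⟨_, hwalg m⟩
  have hsum : ∑ m ∈ p.support, w m * m.prod (fun i e => φ (z i) ^ e) = 0 := by
    apply Subtype.val_injective
    have h1 : algebraMap E L (MvPolynomial.aeval z p) = 0 := by rw [hp, map_zero]
    rw [MvPolynomial.aeval_def, MvPolynomial.eval₂_eq, map_sum] at h1
    have h2 : W.subtype (∑ m ∈ p.support, w m * m.prod (fun i e => φ (z i) ^ e)) =
        (algebraMap D L c)⁻¹ * ∑ m ∈ p.support, algebraMap E L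
          (algebraMap D E (p.coeff m) * ∏ i ∈ m.support, z i ^ m i) := by
      rw [map_sum, Finset.mul_sum]
      refine Finset.sum_congr rfl fun m _ => ?_
      rw [map_mul, map_mul, map_prod, Finsupp.prod, map_prod,
        ← IsScalarTower.algebraMap_apply D E L, ← mul_assoc]
      congr 1
      · change algebraMap D L (p.coeff m) / algebraMap D L c = _
        rw [div_eq_mul_inv, mul_comm]
      · exact Finset.prod_congr rfl fun i _ => by rw [map_pow, map_pow]; rfl
    rw [h1, mul_zero] at h2
    exact h2
  have hP : MvPolynomial.aeval (fun i => ψ (z i)) P = 0 := by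
    have := congrArg (IsLocalRing.residue W) hsum
    rw [map_zero, map_sum] at this
    rw [← this, map_sum]
    refine Finset.sum_congr rfl fun m _ => ?_
    rw [MvPolynomial.aeval_monomial, map_mul, Finsupp.prod, Finsupp.prod, map_prod]
    rfl
  have hP0 := (algebraicIndependent_iff.mp hzA) P hP
  have h1 := congrArg (MvPolynomial.coeff m₀) hP0
  rw [MvPolynomial.coeff_sum, MvPolynomial.coeff_zero, Finset.sum_eq_single_of_mem m₀ hm₀
    (fun m _ hm => by rw [MvPolynomial.coeff_monomial, if_neg hm]), MvPolynomial.coeff_monomial,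
    if_pos rfl] at h1
  have h2 : IsLocalRing.residue W (w m₀) = 0 := congrArg Subtype.val h1
  have h3 : w m₀ = 1 := Subtype.ext (div_self hcL)
  rw [h3, map_one] at h2
  exact one_ne_zero h2

/-! ### Zariski's main theorem and uppers to zero in finite type extensions. -/

/-- A finite type algebra is quasi-finite at a prime incomparable to the other primes of its
fibre. -/
theorem quasiFiniteAt_of_isolated {R S : Type*} [CommRing R] [CommRing S] [Algebra R S]
    [Algebra.FiniteType R S] (q : Ideal S) [hq : q.IsPrime]
    (hmin : ∀ q' : Ideal S, q'.IsPrime → q'.under R = q.under R → q' ≤ q → q' = q)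
    (hmax : ∀ q' : Ideal S, q'.IsPrime → q'.under R = q.under R → q ≤ q' → q' = q) :
    Algebra.QuasiFiniteAt R q := by
  let x : PrimeSpectrum S := ⟨q, hq⟩
  refine Algebra.QuasiFiniteAt.of_isOpen_singleton_fiber x ?_
  let p := x.comap (algebraMap R S)
  let e := PrimeSpectrum.preimageHomeomorphFiber R S p
  let o := PrimeSpectrum.preimageOrderIsoFiber R S p
  have heo : ∀ y, e y = o y := fun y => rfl
  rw [← e.isOpen_image, Set.image_singleton]
  have : IsNoetherianRing (p.asIdeal.Fiber S) :=
    Algebra.FiniteType.isNoetherianRing p.asIdeal.ResidueField _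
  have : IsJacobsonRing (p.asIdeal.Fiber S) :=
    isJacobsonRing_of_finiteType (A := p.asIdeal.ResidueField)
  -- The fibre ring is Noetherian and Jacobson, so a point is open once it is closed (`hmax`) and
  -- stable under generization (`hmin`).
  rw [(PrimeSpectrum.isOpen_singleton_tfae_of_isNoetherian_of_isJacobsonRing _).out 0 2 rfl rfl,
    PrimeSpectrum.isClosed_singleton_iff_isMaximal, ← PrimeSpectrum.isMax_iff]
  have hunder : ∀ y : PrimeSpectrum.comap (algebraMap R S) ⁻¹' {p},
      y.1.asIdeal.under R = q.under R := fun y => congrArg PrimeSpectrum.asIdeal y.2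
  constructor
  · intro Q hQ
    obtain ⟨y, rfl⟩ := o.surjective Q
    rw [heo] at hQ ⊢
    have h1 := o.le_iff_le.mp hQ
    have h2 : y.1.asIdeal = q := hmax _ y.1.isPrime (hunder y) h1
    exact o.le_iff_le.mpr h2.le
  · intro Q Q' hQ' hQ
    rw [Set.mem_singleton_iff] at hQ ⊢
    subst hQ
    obtain ⟨y, rfl⟩ := o.surjective Q'
    rw [← PrimeSpectrum.le_iff_specializes, heo] at hQ'
    have h1 := o.le_iff_le.mp hQ'
    have h2 : y.1.asIdeal = q := hmin _ y.1.isPrime (hunder y) h1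
    rw [heo]
    exact congrArg o (Subtype.ext (PrimeSpectrum.ext h2))

/-- A form of `NoUppersBelow.algebraicIndependent` in terms of coefficients. -/
theorem NoUppersBelow.algebraicIndependent_of_coeff_mem {D E ι : Type*} [CommRing D] [IsDomain D]
    [CommRing E] [IsDomain E] [Algebra D E] (hinj : Function.Injective (algebraMap D E))
    (n : Ideal E) [n.IsPrime] (hM : NoUppersBelow (n.under D)) (z : ι → E)
    (hz : ∀ f : MvPolynomial ι D, MvPolynomial.aeval z f ∈ n → ∀ m, f.coeff m ∈ n.under D) :
    AlgebraicIndependent D z := by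
  refine hM.algebraicIndependent hinj n z (algebraicIndependent_iff.mpr fun p hp => ?_)
  obtain ⟨f, rfl⟩ := MvPolynomial.map_surjective _ Ideal.Quotient.mk_surjective p
  have h1 : Ideal.Quotient.mk n (MvPolynomial.aeval z f) = 0 := by
    rw [← hp, MvPolynomial.aeval_def, MvPolynomial.aeval_def, MvPolynomial.eval₂_map,
      MvPolynomial.hom_eval₂]
    rfl
  ext m
  rw [MvPolynomial.coeff_map, MvPolynomial.coeff_zero]
  exact Ideal.Quotient.eq_zero_iff_mem.mpr (hz f (Ideal.Quotient.eq_zero_iff_mem.mp h1) m)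

/-- In a finite type extension `B` of `D`, let `N` be a height one prime whose contraction `M` is
nonzero.  If `y` lifts a transcendence basis of `B ⧸ N` over `D ⧸ M`, then `B` becomes integral
over `D[y]` after inverting an element outside `N`. -/
theorem exists_notMem_isIntegral_of_isTranscendenceBasis {D B ι : Type*} [CommRing D]
    [CommRing B] [IsDomain B] [Algebra D B] [Algebra.FiniteType D B] (N : Ideal B) [N.IsPrime]
    (hN : ∀ q : Ideal B, q.IsPrime → q ≤ N → q = ⊥ ∨ q = N) (hN0 : N.under D ≠ ⊥)
    (hinj : Function.Injective (algebraMap D B)) (y : ι → B)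
    (hy : IsTranscendenceBasis (D ⧸ N.under D) (fun i => Ideal.Quotient.mk N (y i))) :
    ∃ r ∉ N, ∀ b, ∃ m, (MvPolynomial.aeval (R := D) y).toRingHom.IsIntegralElem (r ^ m * b) := by
  let : Algebra (MvPolynomial ι D) B := (MvPolynomial.aeval (R := D) y).toRingHom.toAlgebra
  have : IsScalarTower D (MvPolynomial ι D) B :=
    .of_algebraMap_eq fun d => ((MvPolynomial.aeval (R := D) y).commutes d).symm
  have : Algebra.FiniteType (MvPolynomial ι D) B := .of_restrictScalars_finiteType D _ _
  have halg : ∀ f : MvPolynomial ι D, algebraMap _ B f = MvPolynomial.aeval y f := fun f => rfl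
  have hD : ∀ q : Ideal B, q.under (MvPolynomial ι D) = N.under (MvPolynomial ι D) →
      q.under D = N.under D := fun q h => by
    rw [← Ideal.under_under (B := MvPolynomial ι D), h, Ideal.under_under]
  -- `N` is isolated in its fibre over `D[y]`. A smaller prime of the fibre would be zero, against
  -- `hN0`. A larger one contains an element that is nonzero and algebraic over `(D ⧸ M)[y]` modulo
  -- `N`, with `M = N ∩ D`, hence an element of `D[y]` outside `N`.
  have : Algebra.QuasiFiniteAt (MvPolynomial ι D) N := by
    refine quasiFiniteAt_of_isolated N (fun q hq hu hle => ?_) (fun q hq hu hle => ?_)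
    · refine (hN q hq hle).resolve_left fun h0 => hN0 ?_
      rw [← hD q hu, h0]
      exact Ideal.comap_bot_of_injective _ hinj
    · refine le_antisymm (fun b hb => ?_) hle
      by_contra hbN
      have halgb := hy.isAlgebraic.isAlgebraic (Ideal.Quotient.mk N b)
      have hb0 : Ideal.Quotient.mk N b ≠ 0 := fun h => hbN (Ideal.Quotient.eq_zero_iff_mem.mp h)
      have hne := Ideal.comap_ne_bot_of_algebraic_mem hb0
        (Ideal.mem_map_of_mem (Ideal.Quotient.mk N) hb) halgb
      obtain ⟨⟨a, ha⟩, haq, ha0⟩ := (Submodule.ne_bot_iff _).mp hne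
      rw [Algebra.adjoin_range_eq_range_aeval] at ha
      obtain ⟨p, rfl⟩ := ha
      obtain ⟨f, rfl⟩ := MvPolynomial.map_surjective _ Ideal.Quotient.mk_surjective p
      have h1 : Ideal.Quotient.mk N (MvPolynomial.aeval y f) =
          MvPolynomial.aeval (fun i => Ideal.Quotient.mk N (y i))
            (MvPolynomial.map (Ideal.Quotient.mk (N.under D)) f) := by
        rw [MvPolynomial.aeval_def, MvPolynomial.aeval_def, MvPolynomial.eval₂_map,
          MvPolynomial.hom_eval₂]
        rfl
      have h2 : Ideal.Quotient.mk N (MvPolynomial.aeval y f) ∈ q.map (Ideal.Quotient.mk N) := by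
        rw [h1]
        exact haq
      have h3 : MvPolynomial.aeval y f ∈ q := by
        rw [← Ideal.mem_comap, Ideal.comap_map_of_surjective _ Ideal.Quotient.mk_surjective,
          ← RingHom.ker_eq_comap_bot, Ideal.mk_ker, sup_eq_left.mpr hle] at h2
        exact h2
      have h4 : f ∈ N.under (MvPolynomial ι D) := hu ▸ h3
      refine ha0 (Subtype.ext ?_)
      exact h1.symm.trans (Ideal.Quotient.eq_zero_iff_mem.mpr h4)
  obtain ⟨r, hr, H⟩ := Algebra.zariskisMainProperty_iff'.mp
    (Algebra.ZariskisMainProperty.of_finiteType (R := MvPolynomial ι D) N)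
  exact ⟨r, hr, H⟩

/-- Over an algebraically independent family `x` of `S`, the family `x`, `X` of `S[X]` is
algebraically independent. -/
theorem algebraicIndependent_option_polynomial {R S ι : Type*} [CommRing R] [CommRing S]
    [Algebra R S] {x : ι → S} (hx : AlgebraicIndependent R x) :
    AlgebraicIndependent R (fun o : Option ι => o.elim (X : S[X]) (fun i => C (x i))) := by
  rw [algebraicIndependent_iff_injective_aeval]
  have h : (MvPolynomial.aeval (fun o : Option ι => o.elim (X : S[X]) (fun i => C (x i)))) =
      (Polynomial.mapAlgHom (MvPolynomial.aeval (R := R) x)).comp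
        (MvPolynomial.optionEquivLeft R ι).toAlgHom := by
    apply MvPolynomial.algHom_ext
    rintro (_ | i) <;> simp [MvPolynomial.optionEquivLeft_apply]
  rw [h, AlgHom.coe_comp]
  exact (Polynomial.map_injective _ hx).comp (MvPolynomial.optionEquivLeft R ι).injective

/-- The absence of uppers to zero below a nonzero prime passes to the height one primes above it
in finite type extensions. -/
theorem NoUppersBelow.of_finiteType {D B : Type*} [CommRing D] [IsDomain D]
    [CommRing B] [IsDomain B] [Algebra D B] [Algebra.FiniteType D B] (N : Ideal B) [N.IsPrime]
    (hN : ∀ q : Ideal B, q.IsPrime → q ≤ N → q = ⊥ ∨ q = N) (hN0 : N.under D ≠ ⊥)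
    (hinj : Function.Injective (algebraMap D B)) (hM : NoUppersBelow (N.under D)) :
    NoUppersBelow N := by
  intro q hq hqB hqN
  by_contra hq0
  have : FaithfulSMul (D ⧸ N.under D) (B ⧸ N) := by
    rw [faithfulSMul_iff_algebraMap_injective]
    exact Ideal.algebraMap_quotient_injective
  obtain ⟨ι, x, hx⟩ := exists_isTranscendenceBasis' (D ⧸ N.under D) (B ⧸ N)
  choose y hy using fun i => Ideal.Quotient.mk_surjective (x i)
  have hxy : x = fun i => Ideal.Quotient.mk N (y i) := funext fun i => (hy i).symm
  rw [hxy] at hx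
  obtain ⟨r, hrN, hr⟩ := exists_notMem_isIntegral_of_isTranscendenceBasis N hN hN0 hinj y hx
  let E := B[X] ⧸ q
  let π : B[X] →+* E := Ideal.Quotient.mk q
  let j : B →ₐ[D] E := (Ideal.Quotient.mkₐ D q).comp (IsScalarTower.toAlgHom D B B[X])
  have hj : Function.Injective j := by
    refine (injective_iff_map_eq_zero j).mpr fun b hb => ?_
    have : b ∈ q.comap (C : B →+* B[X]) :=
      Ideal.mem_comap.mpr (Ideal.Quotient.eq_zero_iff_mem.mp hb)
    rwa [hqB, Ideal.mem_bot] at this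
  have hDE : Function.Injective (algebraMap D E) := by
    rw [← j.comp_algebraMap]
    exact hj.comp hinj
  let NX : Ideal B[X] := N.map C
  have hNX : NX.IsPrime := Ideal.isPrime_map_C_of_isPrime
  let n : Ideal E := NX.map π
  have hnc : n.comap π = NX := by
    rw [Ideal.comap_map_of_surjective _ Ideal.Quotient.mk_surjective,
      ← RingHom.ker_eq_comap_bot, Ideal.mk_ker, sup_eq_left.mpr hqN]
  have hn : n.IsPrime := Ideal.map_isPrime_of_surjective Ideal.Quotient.mk_surjective
    (by rwa [Ideal.mk_ker])
  have hnD : n.under D = N.under D := by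
    have : n.comap (π.comp C) = N := by
      rw [← Ideal.comap_comap, hnc]
      exact Ideal.comap_C_map_C N
    change n.comap (algebraMap D E) = _
    conv_rhs => rw [← this]
    rfl
  let z' : Option ι → B[X] := fun o => o.elim X (fun i => C (y i))
  -- `E ⧸ n` is `(B ⧸ N)[X]`, where `y` and `X` are independent over `D ⧸ (N ∩ D)`.
  have hz : AlgebraicIndependent D (fun o => π (z' o)) := by
    refine NoUppersBelow.algebraicIndependent_of_coeff_mem hDE n (hnD ▸ hM) _ fun f hf m => ?_
    have h1 : MvPolynomial.aeval (fun o => π (z' o)) f = π (MvPolynomial.aeval z' f) := by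
      rw [MvPolynomial.aeval_def, MvPolynomial.aeval_def, MvPolynomial.hom_eval₂]
      rfl
    rw [h1, ← Ideal.mem_comap, hnc, Ideal.mem_map_C_iff] at hf
    have h2 := algebraicIndependent_iff.mp (algebraicIndependent_option_polynomial hx.1)
      (MvPolynomial.map (Ideal.Quotient.mk (N.under D)) f) (by
        have h3 : (MvPolynomial.aeval z' f).map (Ideal.Quotient.mk N) = 0 := by
          ext i
          rw [coeff_map, coeff_zero]
          exact Ideal.Quotient.eq_zero_iff_mem.mpr (hf i)
        rw [← h3, MvPolynomial.aeval_def, MvPolynomial.aeval_def, MvPolynomial.eval₂_map,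
          ← coe_mapRingHom, MvPolynomial.hom_eval₂]
        congr 1
        · ext d
          simp [IsScalarTower.algebraMap_apply D B B[X]]
        · funext o
          cases o <;> simp [z'])
    have h4 := congrArg (MvPolynomial.coeff m) h2
    rw [MvPolynomial.coeff_map, MvPolynomial.coeff_zero] at h4
    rw [hnD]
    exact Ideal.Quotient.eq_zero_iff_mem.mp h4
  have hopt : (fun o => π (z' o)) = fun o : Option ι => o.elim (π X) (fun i => j (y i)) := by
    funext o
    cases o <;> rfl
  rw [hopt, AlgebraicIndependent.option_iff] at hz
  let S := Algebra.adjoin D (Set.range fun i => j (y i))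
  let T := Subalgebra.algebraicClosure S E
  have hint : ∀ b, (MvPolynomial.aeval (R := D) y).toRingHom.IsIntegralElem b →
      IsAlgebraic S (j b) := by
    rintro b ⟨p, hp, hpb⟩
    refine IsIntegral.isAlgebraic ?_
    have hmem : ∀ f : MvPolynomial ι D, j (MvPolynomial.aeval y f) ∈ S := fun f => by
      rw [MvPolynomial.comp_aeval_apply]
      exact (Algebra.adjoin_range_eq_range_aeval D (fun i => j (y i))).ge ⟨f, rfl⟩
    let s : MvPolynomial ι D →+* S :=
      (j.toRingHom.comp (MvPolynomial.aeval (R := D) y).toRingHom).codRestrict S hmem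
    refine ⟨p.map s, hp.map s, ?_⟩
    have := congrArg j.toRingHom hpb
    rw [eval₂_map]
    rw [hom_eval₂, map_zero] at this
    exact this
  -- A power of `r` is integral over `D[y]`, so `r` is algebraic; as `r ≠ 0`, it can be cancelled
  -- from `r ^ m * b`.
  have hBT : ∀ b, j b ∈ T := fun b => by
    obtain ⟨m, hm⟩ := hr b
    obtain ⟨m₂, hm₂⟩ := hr r
    have hr0 : r ≠ 0 := fun h => hrN (h ▸ N.zero_mem)
    have h1 : IsAlgebraic S (j (r ^ (m₂ + 1))) := by
      rw [pow_succ]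
      exact hint _ hm₂
    have h2 : IsAlgebraic S (j r) := by
      rw [map_pow] at h1
      exact h1.of_pow (Nat.succ_pos _)
    have h3 : IsAlgebraic S (j r ^ m * j b) := by
      rw [← map_pow, ← map_mul]
      exact hint _ hm
    refine IsAlgebraic.of_mul (y := j r ^ m)
      (mem_nonZeroDivisors_of_ne_zero (pow_ne_zero _ ?_)) (h2.pow m) h3
    exact fun h => hr0 (hj (h.trans (map_zero j).symm))
  -- A nonzero `g ∈ q` has coefficients in `B`, hence in `T`, and vanishes at the class of `X`.
  have htr : Transcendental T (π X) := hz.2.subalgebraAlgebraicClosure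
  obtain ⟨g, hg, hg0⟩ := (Submodule.ne_bot_iff q).mp hq0
  let jT : B →+* T := j.toRingHom.codRestrict T hBT
  have hjT : Function.Injective jT := fun a b h => hj (congrArg Subtype.val h)
  refine htr ⟨g.map jT, (Polynomial.map_ne_zero_iff hjT).mpr hg0, ?_⟩
  rw [aeval_def, eval₂_map]
  have h1 : π g = 0 := Ideal.Quotient.eq_zero_iff_mem.mpr hg
  rw [← h1]
  conv_rhs => rw [← eval₂_C_X (p := g), hom_eval₂]
  rfl

/-! ### Noetherian localizations and uppers to zero. -/

/-- By Krull's principal ideal theorem there are no uppers to zero below a height one prime of a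
Noetherian domain. -/
theorem NoUppersBelow.of_isNoetherianRing {R : Type*} [CommRing R] [IsDomain R]
    [IsNoetherianRing R] (N : Ideal R) [N.IsPrime]
    (hN : ∀ q : Ideal R, q.IsPrime → q ≤ N → q = ⊥ ∨ q = N) : NoUppersBelow N := by
  intro q hq hqR hqN
  by_contra hq0
  have hN0 : N ≠ ⊥ := by
    rintro rfl
    rw [Ideal.map_bot] at hqN
    exact hq0 (le_bot_iff.mp hqN)
  obtain ⟨a, ha, ha0⟩ := (Submodule.ne_bot_iff N).mp hN0
  have hNX : (N.map (C : R →+* R[X])).IsPrime := Ideal.isPrime_map_C_of_isPrime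
  have hCa : C a ∈ N.map (C : R →+* R[X]) := Ideal.mem_map_of_mem _ ha
  -- A prime below `N[X]` containing `a` contracts to `N` by height one, so it contains `N[X]`.
  -- Krull then bounds the height of `N[X]` by one, against `0 < q < N[X]`.
  have hmin : N.map (C : R →+* R[X]) ∈ (Ideal.span {C a}).minimalPrimes := by
    refine ⟨⟨hNX, (Ideal.span_singleton_le_iff_mem _).mpr hCa⟩, fun p hp hpN => ?_⟩
    have hp1 := hp.1
    have hle : p.comap C ≤ N := (Ideal.comap_mono hpN).trans (Ideal.comap_C_map_C N).le
    have hap : a ∈ p.comap C :=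
      Ideal.mem_comap.mpr ((Ideal.span_singleton_le_iff_mem _).mp hp.2)
    have hpc : p.comap C = N := (hN _ (Ideal.comap_isPrime C p) hle).resolve_left fun h =>
      ha0 (by rwa [h, Ideal.mem_bot] at hap)
    rw [Ideal.map_le_iff_le_comap, hpc]
  have hht := Ideal.height_le_one_of_isPrincipal_of_mem_minimalPrimes (Ideal.span {C a}) _ hmin
  have hlt : q < N.map C := lt_of_le_of_ne hqN fun h => ha0 (by
    have : a ∈ q.comap C := by rw [h]; exact hCa
    rwa [hqR, Ideal.mem_bot] at this)
  have hbot : (⊥ : Ideal R[X]).IsPrime := Ideal.isPrime_bot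
  have h1 := Ideal.height_add_one_le_of_lt_of_isPrime hlt
  have h2 := Ideal.height_add_one_le_of_lt_of_isPrime (bot_lt_iff_ne_bot.mpr hq0)
  have h3 : (2 : ℕ∞) ≤ 1 := calc
    (2 : ℕ∞) = 0 + 1 + 1 := by norm_num
    _ ≤ (⊥ : Ideal R[X]).height + 1 + 1 := by gcongr; exact zero_le
    _ ≤ q.height + 1 := by gcongr
    _ ≤ 1 := h1.trans hht
  exact absurd h3 (by decide)

/-- There are no uppers to zero below a height one prime with Noetherian localization. -/
theorem NoUppersBelow.of_isNoetherianRing_localization {R : Type*} [CommRing R] [IsDomain R]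
    (N : Ideal R) [N.IsPrime] [IsNoetherianRing (Localization.AtPrime N)]
    (hN : ∀ q : Ideal R, q.IsPrime → q ≤ N → q = ⊥ ∨ q = N) : NoUppersBelow N := by
  let S := Localization.AtPrime N
  have hS : IsDomain S := IsLocalization.isDomain_localization N.primeCompl_le_nonZeroDivisors
  have hinj : Function.Injective (algebraMap R S) :=
    IsLocalization.injective S N.primeCompl_le_nonZeroDivisors
  have hmax : (IsLocalRing.maximalIdeal S).comap (algebraMap R S) = N :=
    IsLocalization.AtPrime.under_maximalIdeal S N
  have hS1 : NoUppersBelow (IsLocalRing.maximalIdeal S) := by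
    refine NoUppersBelow.of_isNoetherianRing _ fun q hq hle => ?_
    have hmap : (q.comap (algebraMap R S)).map (algebraMap R S) = q :=
      IsLocalization.map_under N.primeCompl S q
    rcases hN _ (Ideal.comap_isPrime (algebraMap R S) q)
      ((Ideal.comap_mono hle).trans hmax.le) with h | h
    · left
      rw [← hmap, h, Ideal.map_bot]
    · right
      rw [← hmap, h]
      exact Localization.AtPrime.map_eq_maximalIdeal
  intro q hq hqR hqN
  -- Since `q` contracts to zero, it meets no denominator and survives in `S[X]`.
  let : Algebra R[X] S[X] := (mapRingHom (algebraMap R S)).toAlgebra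
  have hloc : IsLocalization (N.primeCompl.map (C : R →+* R[X])) S[X] :=
    Polynomial.isLocalization N.primeCompl S
  have hdisj : Disjoint (N.primeCompl.map (C : R →+* R[X]) : Set R[X]) (q : Set R[X]) := by
    rw [Set.disjoint_left]
    rintro _ ⟨s, hs, rfl⟩ hsq
    have : s ∈ q.comap C := hsq
    rw [hqR, Ideal.mem_bot] at this
    exact hs (this ▸ N.zero_mem)
  have hq' := IsLocalization.isPrime_of_isPrime_disjoint _ S[X] q hq hdisj
  have hcm : (q.map (algebraMap R[X] S[X])).comap (algebraMap R[X] S[X]) = q :=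
    IsLocalization.under_map_of_isPrime_disjoint _ S[X] hq hdisj
  have h0 := hS1 (q.map (algebraMap R[X] S[X])) hq' ?_ ?_
  · rw [← hcm, h0]
    exact Ideal.comap_bot_of_injective _ (Polynomial.map_injective _ hinj)
  · have : (q.map (algebraMap R[X] S[X])).comap (C.comp (algebraMap R S)) = ⊥ := by
      have hc : (C : S →+* S[X]).comp (algebraMap R S) = (algebraMap R[X] S[X]).comp C := by
        ext r : 1
        exact (Polynomial.map_C _).symm
      rw [hc, ← Ideal.comap_comap, hcm, hqR]
    rw [← IsLocalization.map_under N.primeCompl S ((q.map (algebraMap R[X] S[X])).comap C),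
      Ideal.under, Ideal.comap_comap, this, Ideal.map_bot]
  · rw [Ideal.map_le_iff_le_comap]
    intro f hf
    rw [Ideal.mem_comap, Ideal.mem_map_C_iff]
    intro i
    have h1 := Ideal.mem_map_C_iff.mp (hqN hf) i
    rw [← hmax] at h1
    have h2 : (algebraMap R[X] S[X] f).coeff i = algebraMap R S (f.coeff i) := coeff_map _ _
    rw [h2]
    exact h1

theorem isNoetherianRing_localization_of_eq_bot {R : Type*} [CommRing R] [IsDomain R]
    (P : Ideal R) [P.IsPrime] (hP : P = ⊥) : IsNoetherianRing (Localization.AtPrime P) := by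
  subst hP
  have : IsField (Localization.AtPrime (⊥ : Ideal R)) := by
    rw [IsLocalRing.isField_iff_maximalIdeal_eq, ← Localization.AtPrime.map_eq_maximalIdeal,
      Ideal.map_bot]
  let := this.toField
  infer_instance

/-- `B_N` is essentially of finite type over `D_{N ∩ D}`, and such algebras inherit Noetherianity.
-/
theorem isNoetherianRing_localization_of_finiteType {D B : Type*} [CommRing D] [CommRing B]
    [Algebra D B] [Algebra.FiniteType D B] (N : Ideal B) [N.IsPrime]
    (h : IsNoetherianRing (Localization.AtPrime (N.under D))) :
    IsNoetherianRing (Localization.AtPrime N) := by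
  let := Localization.AtPrime.algebraOfLiesOver (N.under D) N
  have : Algebra.EssFiniteType D (Localization.AtPrime N) :=
    Algebra.EssFiniteType.comp D B (Localization.AtPrime N)
  have : Algebra.EssFiniteType (Localization.AtPrime (N.under D)) (Localization.AtPrime N) :=
    Algebra.EssFiniteType.of_comp D _ _
  exact Algebra.EssFiniteType.isNoetherianRing (Localization.AtPrime (N.under D)) _

/-! ### From uppers to zero to adjacency of extended primes. -/

/-- Adjacent primes extend to adjacent primes of the polynomial ring if, modulo the smaller one,
there are no uppers to zero below the larger one. -/
theorem not_between_map_C_of_noUppersBelow {A : Type*} [CommRing A] (Q₁ Q₂ : Ideal A)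
    (hadj : ∀ q : Ideal A, q.IsPrime → Q₁ < q → ¬ q < Q₂)
    (hup : NoUppersBelow (Q₂.map (Ideal.Quotient.mk Q₁)))
    (q : Ideal A[X]) (hq : q.IsPrime) (h1 : Q₁.map (C : A →+* A[X]) < q) :
    ¬ q < Q₂.map (C : A →+* A[X]) := by
  intro h2
  have hle1 : Q₁ ≤ q.comap C := Ideal.map_le_iff_le_comap.mp h1.le
  have hle2 : q.comap C ≤ Q₂ := (Ideal.comap_mono h2.le).trans (Ideal.comap_C_map_C Q₂).le
  -- By adjacency the contraction is `Q₁` or `Q₂`, and `Q₂` would give `Q₂[X] ≤ q`.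
  have hQ1 : q.comap C = Q₁ := by
    by_contra hne
    have hlt := lt_of_le_of_ne hle1 (Ne.symm hne)
    have heq : q.comap C = Q₂ := by
      by_contra hne2
      exact hadj _ (Ideal.comap_isPrime C q) hlt (lt_of_le_of_ne hle2 hne2)
    exact h2.not_ge (Ideal.map_le_iff_le_comap.mpr heq.ge)
  let f : A[X] →+* (A ⧸ Q₁)[X] := mapRingHom (Ideal.Quotient.mk Q₁)
  have hf : Function.Surjective f := Polynomial.map_surjective _ Ideal.Quotient.mk_surjective
  have hker : RingHom.ker f = Q₁.map C := by
    rw [Polynomial.ker_mapRingHom, Ideal.mk_ker]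
  have hkq : RingHom.ker f ≤ q := hker ▸ h1.le
  have hcm : (q.map f).comap f = q := by
    rw [Ideal.comap_map_of_surjective _ hf, ← RingHom.ker_eq_comap_bot, sup_eq_left.mpr hkq]
  have h0 := hup (q.map f) (Ideal.map_isPrime_of_surjective hf hkq) ?_ ?_
  · refine h1.not_ge ?_
    rw [← hker, ← Ideal.map_eq_bot_iff_le_ker]
    exact h0
  · refine le_bot_iff.mp fun c hc => ?_
    obtain ⟨c, rfl⟩ := Ideal.Quotient.mk_surjective c
    have h3 : C c ∈ (q.map f).comap f := by
      rw [Ideal.mem_comap]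
      have : f (C c) = C (Ideal.Quotient.mk Q₁ c) := Polynomial.map_C _
      rwa [this]
    rw [hcm] at h3
    have h4 : c ∈ q.comap C := h3
    rw [hQ1] at h4
    exact Ideal.Quotient.eq_zero_iff_mem.mpr h4
  · rw [Ideal.map_le_iff_le_comap]
    intro g hg
    rw [Ideal.mem_comap, Ideal.mem_map_C_iff]
    intro i
    have := Ideal.mem_map_of_mem (Ideal.Quotient.mk Q₁) (Ideal.mem_map_C_iff.mp (h2.le hg) i)
    rwa [← coeff_map] at this

theorem comap_map_mk_of_le {A : Type*} [CommRing A] {Q₁ Q₂ : Ideal A} (hle : Q₁ ≤ Q₂) :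
    (Q₂.map (Ideal.Quotient.mk Q₁)).comap (Ideal.Quotient.mk Q₁) = Q₂ := by
  rw [Ideal.comap_map_of_surjective _ Ideal.Quotient.mk_surjective,
    ← RingHom.ker_eq_comap_bot, Ideal.mk_ker, sup_eq_left.mpr hle]

/-- The correspondence of primes turns adjacency into the height one hypothesis of the
`NoUppersBelow` lemmas. -/
theorem eq_bot_or_eq_of_le_map_mk {A : Type*} [CommRing A] {Q₁ Q₂ : Ideal A}
    (hadj : ∀ q : Ideal A, q.IsPrime → Q₁ < q → ¬ q < Q₂) (hle : Q₁ ≤ Q₂)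
    (q : Ideal (A ⧸ Q₁)) (hq : q.IsPrime) (hq2 : q ≤ Q₂.map (Ideal.Quotient.mk Q₁)) :
    q = ⊥ ∨ q = Q₂.map (Ideal.Quotient.mk Q₁) := by
  have hmap := Ideal.map_comap_of_surjective _ (Ideal.Quotient.mk_surjective (I := Q₁)) q
  have h1 : Q₁ ≤ q.comap (Ideal.Quotient.mk Q₁) := by
    conv_lhs => rw [← Ideal.mk_ker (I := Q₁)]
    exact Ideal.comap_mono bot_le
  have h2 : q.comap (Ideal.Quotient.mk Q₁) ≤ Q₂ := by
    exact (Ideal.comap_mono hq2).trans (comap_map_mk_of_le hle).le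
  by_cases h : q.comap (Ideal.Quotient.mk Q₁) = Q₁
  · left
    rw [← hmap, h, Ideal.map_quotient_self]
  · right
    have h3 : q.comap (Ideal.Quotient.mk Q₁) = Q₂ := by
      by_contra hne
      exact hadj _ (Ideal.comap_isPrime _ q) (lt_of_le_of_ne h1 (Ne.symm h))
        (lt_of_le_of_ne h2 hne)
    rw [← hmap, h3]

section Quotient

variable {D A : Type*} [CommRing D] [CommRing A] [Algebra D A] {Q₁ Q₂ : Ideal A}

theorem under_map_mk_of_le (hle : Q₁ ≤ Q₂) :
    (Q₂.map (Ideal.Quotient.mk Q₁)).under D = Q₂.under D := by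
  conv_rhs => rw [← comap_map_mk_of_le hle]
  rfl

theorem isPrime_map_mk_of_le (hle : Q₁ ≤ Q₂) (hQ₂ : Q₂.IsPrime) :
    (Q₂.map (Ideal.Quotient.mk Q₁)).IsPrime :=
  Ideal.map_isPrime_of_surjective Ideal.Quotient.mk_surjective (by rwa [Ideal.mk_ker])

/-- Let `A` be of finite type over `D`.  Adjacent primes of `A` extend to adjacent primes of
`A[X]` if the localization of `D` at the contraction of the larger one is Noetherian. -/
theorem not_between_map_C_of_isNoetherianRing [Algebra.FiniteType D A]
    [hQ₁ : Q₁.IsPrime] [hQ₂ : Q₂.IsPrime] (hle : Q₁ ≤ Q₂)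
    (hadj : ∀ q : Ideal A, q.IsPrime → Q₁ < q → ¬ q < Q₂)
    (hD : IsNoetherianRing (Localization.AtPrime (Q₂.under D)))
    (q : Ideal A[X]) (hq : q.IsPrime) (h1 : Q₁.map (C : A →+* A[X]) < q) :
    ¬ q < Q₂.map (C : A →+* A[X]) := by
  refine not_between_map_C_of_noUppersBelow Q₁ Q₂ hadj ?_ q hq h1
  have := isPrime_map_mk_of_le hle hQ₂
  have : IsNoetherianRing (Localization.AtPrime (Q₂.map (Ideal.Quotient.mk Q₁))) := by
    refine isNoetherianRing_localization_of_finiteType (D := D) _ ?_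
    have hcongr : ∀ (P P' : Ideal D) [P.IsPrime] [P'.IsPrime], P = P' →
        IsNoetherianRing (Localization.AtPrime P') → IsNoetherianRing (Localization.AtPrime P) := by
      rintro P P' _ _ rfl h
      exact h
    exact hcongr _ _ (under_map_mk_of_le hle) hD
  exact NoUppersBelow.of_isNoetherianRing_localization _ (eq_bot_or_eq_of_le_map_mk hadj hle)

/-- Let `A` be of finite type over `D`.  Adjacent primes of `A` extend to adjacent primes of
`A[X]` if all primes of `D[X]` inside the extension of the contraction of the larger one are
extended. -/
theorem not_between_map_C_of_extended [Algebra.FiniteType D A]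
    [hQ₁ : Q₁.IsPrime] [hQ₂ : Q₂.IsPrime] (hle : Q₁ ≤ Q₂)
    (hadj : ∀ q : Ideal A, q.IsPrime → Q₁ < q → ¬ q < Q₂)
    (hD : ∀ Q : Ideal D[X], Q.IsPrime → Q ≤ (Q₂.under D).map (C : D →+* D[X]) →
      Q = (Q.comap (C : D →+* D[X])).map (C : D →+* D[X]))
    (q : Ideal A[X]) (hq : q.IsPrime) (h1 : Q₁.map (C : A →+* A[X]) < q) :
    ¬ q < Q₂.map (C : A →+* A[X]) := by
  refine not_between_map_C_of_noUppersBelow Q₁ Q₂ hadj ?_ q hq h1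
  have hNp := isPrime_map_mk_of_le hle hQ₂
  set N := Q₂.map (Ideal.Quotient.mk Q₁) with hN
  let D₁ := D ⧸ Q₁.under D
  have : Algebra.FiniteType D₁ (A ⧸ Q₁) := .of_restrictScalars_finiteType D _ _
  have hinj : Function.Injective (algebraMap D₁ (A ⧸ Q₁)) := Ideal.algebraMap_quotient_injective
  have hht := eq_bot_or_eq_of_le_map_mk hadj hle
  -- `NoUppersBelow.of_finiteType` needs a nonzero contraction. Over zero, `D₁` localizes to a field
  -- and the Noetherian argument applies.
  by_cases h0 : N.under D₁ = ⊥
  · have : IsNoetherianRing (Localization.AtPrime N) :=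
      isNoetherianRing_localization_of_finiteType (D := D₁) _
        (isNoetherianRing_localization_of_eq_bot _ h0)
    exact NoUppersBelow.of_isNoetherianRing_localization _ hht
  refine NoUppersBelow.of_finiteType (D := D₁) N hht h0 hinj fun Q hQ hQ0 hQN => ?_
  let f : D[X] →+* D₁[X] := mapRingHom (Ideal.Quotient.mk (Q₁.under D))
  have hf : Function.Surjective f := Polynomial.map_surjective _ Ideal.Quotient.mk_surjective
  have hfC : f.comp C = (C : D₁ →+* D₁[X]).comp (Ideal.Quotient.mk (Q₁.under D)) := by
    ext d : 1
    exact Polynomial.map_C _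
  -- The preimage of `Q` in `D[X]` contracts to `Q₁ ∩ D`. Being extended, it is the kernel of `f`,
  -- so `Q = 0`.
  have hext := hD (Q.comap f) (Ideal.comap_isPrime f Q) ?_
  · have h2 : (Q.comap f).comap C = Q₁.under D := by
      rw [Ideal.comap_comap, hfC, ← Ideal.comap_comap, hQ0, ← RingHom.ker_eq_comap_bot,
        Ideal.mk_ker]
    rw [h2] at hext
    rw [← Ideal.map_comap_of_surjective f hf Q, hext, Ideal.map_map, hfC, ← Ideal.map_map,
      Ideal.map_quotient_self, Ideal.map_bot]
  · intro g hg
    rw [Ideal.mem_map_C_iff]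
    intro i
    have h2 := Ideal.mem_map_C_iff.mp (hQN (Ideal.mem_comap.mp hg)) i
    rw [← under_map_mk_of_le hle, ← Ideal.under_under (B := D₁)]
    have h3 : (f g).coeff i = algebraMap D D₁ (g.coeff i) := coeff_map _ _
    rw [h3] at h2
    exact h2

end Quotient

/-! ### Semistar operations governed by a set of primes. -/

namespace SemistarOperation

section Controlled

variable {A : Type u} {L : Type v} [CommRing A] [Field L] [Algebra A L]

theorem algebraMap_mem_coeSubmodule [IsDomain A] [IsFractionRing A L] {I : Ideal A} {x : A} :
    algebraMap A L x ∈ IsLocalization.coeSubmodule L I ↔ x ∈ I := by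
  rw [IsLocalization.mem_coeSubmodule]
  refine ⟨?_, fun h => ⟨x, h, rfl⟩⟩
  rintro ⟨y, hy, h⟩
  rwa [← IsFractionRing.injective A L h]

theorem coeSubmodule_ne_bot [IsDomain A] [IsFractionRing A L] {I : Ideal A} (hI : I ≠ ⊥) :
    IsLocalization.coeSubmodule L I ≠ ⊥ := by
  obtain ⟨a, ha, ha0⟩ := (Submodule.ne_bot_iff I).mp hI
  exact (Submodule.ne_bot_iff _).mpr ⟨algebraMap A L a, algebraMap_mem_coeSubmodule.mpr ha,
    fun h => ha0 (IsFractionRing.injective A L (h.trans (map_zero _).symm))⟩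

/-- Finitely generated submodules of an integral ideal come from finitely generated ideals. -/
theorem exists_fg_ideal_of_le_coeSubmodule [IsDomain A] [IsFractionRing A L] {I : Ideal A}
    {F : Submodule A L} (hF : F.FG) (hF0 : F ≠ ⊥) (hFI : F ≤ IsLocalization.coeSubmodule L I) :
    ∃ J : Ideal A, J.FG ∧ J ≠ ⊥ ∧ J ≤ I ∧ IsLocalization.coeSubmodule L J = F := by
  let J : Ideal A := F.comap (Algebra.linearMap A L)
  have hJ : IsLocalization.coeSubmodule L J = F := by
    refine Submodule.map_comap_eq_self (hFI.trans ?_)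
    exact LinearMap.map_le_range
  refine ⟨J, ?_, ?_, ?_, hJ⟩
  · refine Submodule.fg_of_fg_map_injective (Algebra.linearMap A L)
      (IsFractionRing.injective A L) ?_
    change (IsLocalization.coeSubmodule L J).FG
    rwa [hJ]
  · intro h
    rw [h, IsLocalization.coeSubmodule_bot] at hJ
    exact hF0 hJ.symm
  · intro x hx
    exact algebraMap_mem_coeSubmodule.mp (hFI hx)

theorem one_mem_finiteType_iff [IsDomain A] [IsFractionRing A L] (star : SemistarOperation A L)
    {I : Ideal A} (hI : I ≠ ⊥) :
    (1 : L) ∈ star.finiteType (IsLocalization.coeSubmodule L I) ↔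
      ∃ J : Ideal A, J.FG ∧ J ≠ ⊥ ∧ J ≤ I ∧ (1 : L) ∈ star (IsLocalization.coeSubmodule L J) := by
  rw [mem_finiteType star (coeSubmodule_ne_bot hI)]
  constructor
  · rintro ⟨F, hF, hF0, hFI, h1⟩
    obtain ⟨J, hJ, hJ0, hJI, rfl⟩ := exists_fg_ideal_of_le_coeSubmodule hF hF0 hFI
    exact ⟨J, hJ, hJ0, hJI, h1⟩
  · rintro ⟨J, hJ, hJ0, hJI, h1⟩
    exact ⟨_, Submodule.FG.map (Algebra.linearMap A L) hJ, coeSubmodule_ne_bot hJ0, IsLocalization.coeSubmodule_mono L hJI, h1⟩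

/-- If `1 ∈ I^{⋆_f}`, then `1 ∈ J^⋆` for a finitely generated `J ≤ I`; so `A ⊆ J^⋆`, and idempotence
gives `A^⋆ ⊆ J^⋆`. -/
theorem finiteType_lt_iff [IsDomain A] [IsFractionRing A L] (star : SemistarOperation A L)
    {I : Ideal A} (hI : I ≠ ⊥) :
    star.finiteType (IsLocalization.coeSubmodule L I) < star (IsLocalization.coeSubmodule L ⊤) ↔
      (1 : L) ∉ star.finiteType (IsLocalization.coeSubmodule L I) := by
  have hle : star.finiteType (IsLocalization.coeSubmodule L I) ≤
      star (IsLocalization.coeSubmodule L ⊤) := by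
    intro x hx
    obtain ⟨F, -, hF0, hFI, hx⟩ := (mem_finiteType star (coeSubmodule_ne_bot hI)).mp hx
    exact star.mono _ _ hF0 (hFI.trans (IsLocalization.coeSubmodule_mono L le_top)) hx
  have htop : (⊤ : Ideal A) ≠ ⊥ := top_ne_bot
  have hone : (1 : L) ∈ star (IsLocalization.coeSubmodule L ⊤) := by
    refine star.le_self _ (coeSubmodule_ne_bot htop) ?_
    rw [← map_one (algebraMap A L)]
    exact algebraMap_mem_coeSubmodule.mpr Submodule.mem_top
  rw [lt_iff_le_and_ne, and_iff_right hle]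
  refine not_congr ⟨fun h => h ▸ hone, fun h => le_antisymm hle ?_⟩
  obtain ⟨J, hJ, hJ0, hJI, h1⟩ := (one_mem_finiteType_iff star hI).mp h
  have htopJ : IsLocalization.coeSubmodule L ⊤ ≤ star (IsLocalization.coeSubmodule L J) := by
    rintro _ ⟨a, -, rfl⟩
    have := (star (IsLocalization.coeSubmodule L J)).smul_mem a h1
    rwa [Algebra.smul_def, mul_one] at this
  have h2 := star.mono _ _ (coeSubmodule_ne_bot htop) htopJ
  rw [star.idem _ (coeSubmodule_ne_bot hJ0)] at h2
  exact fun x hx => (mem_finiteType star (coeSubmodule_ne_bot hI)).mpr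
    ⟨_, Submodule.FG.map (Algebra.linearMap A L) hJ, coeSubmodule_ne_bot hJ0, IsLocalization.coeSubmodule_mono L hJI, h2 hx⟩

/-- The operation `star` behaves on integral ideals like the spectral operation of a set `Δ` of
primes that contains zero, is stable under generization, and is quasi-compact. -/
structure IsControlledBy (star : SemistarOperation A L) (Δ : Set (Ideal A)) : Prop where
  isPrime : ∀ P ∈ Δ, P.IsPrime
  bot_mem : ⊥ ∈ Δ
  mem_of_le : ∀ P ∈ Δ, ∀ Q : Ideal A, Q.IsPrime → Q ≤ P → Q ∈ Δ
  -- Finite generation matters because denominators of `⋆[X]` are polynomials, whose content ideals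
  -- are finitely generated.
  exists_fg : ∀ P : Ideal A, P.IsPrime → P ∉ Δ →
    ∃ F : Ideal A, F.FG ∧ F ≤ P ∧ ∀ Q ∈ Δ, ¬ F ≤ Q
  one_mem : ∀ F : Ideal A, F.FG → (∀ Q ∈ Δ, ¬ F ≤ Q) →
    (1 : L) ∈ star (IsLocalization.coeSubmodule L F)
  mem_of_mem : ∀ P ∈ Δ, P ≠ ⊥ → ∀ x : A,
    algebraMap A L x ∈ star (IsLocalization.coeSubmodule L P) → x ∈ P

variable {star : SemistarOperation A L} {Δ : Set (Ideal A)}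

theorem IsControlledBy.one_notMem (h : star.IsControlledBy Δ) {P : Ideal A} (hP : P ∈ Δ)
    (hP0 : P ≠ ⊥) : (1 : L) ∉ star (IsLocalization.coeSubmodule L P) := fun h1 =>
  (h.isPrime P hP).one_notMem (h.mem_of_mem P hP hP0 1 (by rwa [map_one]))

theorem IsControlledBy.ne_bot (h : star.IsControlledBy Δ) {F : Ideal A}
    (hF : ∀ Q ∈ Δ, ¬ F ≤ Q) : F ≠ ⊥ := fun h0 => hF ⊥ h.bot_mem h0.le

variable [IsDomain A] [IsFractionRing A L]

/-- A prime outside `Δ` contains some `F` with `1 ∈ F^⋆`, so its closure contains `1`. -/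
theorem IsControlledBy.isQuasiPrime_iff (h : star.IsControlledBy Δ) {P : Ideal A}
    (hP : P.IsPrime) (hP0 : P ≠ ⊥) : star.IsQuasiPrime P ↔ P ∈ Δ := by
  constructor
  · rintro ⟨-, -, hq⟩
    by_contra hPΔ
    obtain ⟨F, hF, hFP, hFΔ⟩ := h.exists_fg P hP hPΔ
    have h1 := star.mono _ _ (coeSubmodule_ne_bot (h.ne_bot hFΔ))
      (IsLocalization.coeSubmodule_mono L hFP) (h.one_mem F hF hFΔ)
    refine hP.one_notMem ?_
    rw [← hq]
    rwa [Submodule.mem_comap, Algebra.linearMap_apply, map_one]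
  · intro hPΔ
    refine ⟨hP, hP0, le_antisymm (fun x hx => h.mem_of_mem P hPΔ hP0 x hx) fun x hx => ?_⟩
    exact star.le_self _ (coeSubmodule_ne_bot hP0) (algebraMap_mem_coeSubmodule.mpr hx)

/-- The witness from `exists_fg` is finitely generated, so `⋆_f` detects `Δ` just as `⋆` does. -/
theorem IsControlledBy.mem_theta_iff (h : star.IsControlledBy Δ) (Q : PrimeSpectrum A[X]) :
    Q ∈ star.theta ↔ Q.asIdeal.comap (C : A →+* A[X]) ∈ Δ := by
  have hQ := Q.isPrime
  have hP : (Q.asIdeal.comap (C : A →+* A[X])).IsPrime := Ideal.comap_isPrime _ _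
  rw [theta, Set.mem_ofPred_eq]
  by_cases h0 : Q.asIdeal.comap (C : A →+* A[X]) = ⊥
  · rw [h0]
    exact iff_of_true (Or.inl rfl) h.bot_mem
  rw [or_iff_right h0, finiteType_lt_iff star h0, one_mem_finiteType_iff star h0]
  constructor
  · intro hno
    by_contra hPΔ
    obtain ⟨F, hF, hFP, hFΔ⟩ := h.exists_fg _ hP hPΔ
    exact hno ⟨F, hF, h.ne_bot hFΔ, hFP, h.one_mem F hF hFΔ⟩
  · rintro hPΔ ⟨J, -, hJ0, hJP, h1⟩
    exact h.one_notMem hPΔ h0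
      (star.mono _ _ (coeSubmodule_ne_bot hJ0) (IsLocalization.coeSubmodule_mono L hJP) h1)

/-- Every finitely generated ideal is the content ideal of a polynomial. -/
theorem exists_polynomial_coeff_span {R : Type*} [CommRing R] {F : Ideal R} (hF : F.FG) :
    ∃ s : R[X], (∀ i, s.coeff i ∈ F) ∧ ∀ Q : Ideal R, (∀ i, s.coeff i ∈ Q) → F ≤ Q := by
  obtain ⟨n, g, rfl⟩ := Submodule.fg_iff_exists_fin_generating_family.mp hF
  have hs : ∀ j : ℕ, (∑ i : Fin n, monomial (i : ℕ) (g i)).coeff j =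
      if h : j < n then g ⟨j, h⟩ else 0 := by
    intro j
    rw [finsetSum_coeff]
    split_ifs with h
    · rw [Finset.sum_eq_single ⟨j, h⟩]
      · rw [coeff_monomial, if_pos rfl]
      · intro i _ hi
        rw [coeff_monomial, if_neg fun hij => hi (Fin.ext hij)]
      · exact fun h' => absurd (Finset.mem_univ _) h'
    · refine Finset.sum_eq_zero fun i _ => ?_
      rw [coeff_monomial, if_neg fun hij : (i : ℕ) = j => h (hij ▸ i.2)]
  refine ⟨∑ i : Fin n, monomial (i : ℕ) (g i), fun j => ?_, fun Q hQ => ?_⟩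
  · rw [hs]
    split_ifs
    · exact Submodule.subset_span ⟨_, rfl⟩
    · exact Submodule.zero_mem _
  · rw [Submodule.span_le]
    rintro _ ⟨i, rfl⟩
    have := hQ i
    rwa [hs, dif_pos i.2] at this

/-- By `mem_theta_iff`, a polynomial is a denominator exactly when its content lies in no prime of
the new set. This yields `one_mem`. For `mem_of_mem`, a denominator has a coefficient outside `P`,
which cancels. Quasi-compactness is witnessed by ideals extended from `A`. -/
theorem IsControlledBy.polynomial (h : star.IsControlledBy Δ) (L₁ : Type u) [Field L₁]
    [Algebra A[X] L₁] [IsFractionRing A[X] L₁] :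
    (star.polynomial L₁).IsControlledBy
      {Q : Ideal A[X] | Q.IsPrime ∧ Q.comap (C : A →+* A[X]) ∈ Δ} where
  isPrime P hP := hP.1
  bot_mem := ⟨Ideal.isPrime_bot, by
    rw [Ideal.comap_bot_of_injective _ C_injective]
    exact h.bot_mem⟩
  mem_of_le P hP Q hQ hle :=
    ⟨hQ, h.mem_of_le _ hP.2 _ (Ideal.comap_isPrime C Q) (Ideal.comap_mono hle)⟩
  exists_fg P hP hPΔ := by
    obtain ⟨F, hF, hFP, hFΔ⟩ := h.exists_fg (P.comap C) (Ideal.comap_isPrime C P)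
      fun h' => hPΔ ⟨hP, h'⟩
    exact ⟨F.map C, Ideal.FG.map hF C, Ideal.map_le_iff_le_comap.mpr hFP,
      fun Q hQ hle => hFΔ _ hQ.2 (Ideal.map_le_iff_le_comap.mp hle)⟩
  one_mem F hF hFΔ := by
    obtain ⟨s, hsF, hs⟩ := exists_polynomial_coeff_span hF
    refine mem_nagata.mpr ⟨s, fun Q hQ hsQ => ?_, fun i => ?_⟩
    · exact hFΔ Q.asIdeal ⟨Q.isPrime, (h.mem_theta_iff Q).mp hQ⟩
        (hs _ (Ideal.mem_map_C_iff.mp hsQ))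
    · rw [Algebra.smul_def, mul_one]
      exact algebraMap_mem_coeSubmodule.mpr (hsF i)
  mem_of_mem P hP _ x hx := by
    obtain ⟨s, hs, hsx⟩ := mem_nagata.mp hx
    have h1 := hs ⟨P, hP.1⟩ ((h.mem_theta_iff _).mpr hP.2)
    rw [Ideal.mem_map_C_iff] at h1
    push Not at h1
    obtain ⟨i, hi⟩ := h1
    have h2 := hsx i
    rw [Algebra.smul_def, ← map_mul, algebraMap_mem_coeSubmodule] at h2
    exact (hP.1.mem_or_mem h2).resolve_left hi

/-! ### The operation `⋆̃` and its primes. -/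

/-- If no finitely generated ideal inside `I` has trivial closure, then `I` lies in a
quasi-`⋆_f`-maximal ideal. -/
theorem exists_le_isQuasiMaximal (star : SemistarOperation A L) {I : Ideal A} (hI : I ≠ ⊥)
    (h1 : (1 : L) ∉ star.finiteType (IsLocalization.coeSubmodule L I)) :
    ∃ M, star.finiteType.IsQuasiMaximal M ∧ I ≤ M := by
  let sf := star.finiteType
  -- Chains have bounds because `⋆_f` is of finite type. By idempotence the closure of `M` also
  -- omits `1`, so maximality makes `M` a quasi-ideal.
  obtain ⟨M, hIM, hM⟩ := zorn_le_nonempty₀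
    {J : Ideal A | I ≤ J ∧ (1 : L) ∉ sf (IsLocalization.coeSubmodule L J)} (by
      intro c hc hchain y hy
      have hIc : I ≤ sSup c := (hc hy).1.trans (le_sSup hy)
      have h0 : sSup c ≠ ⊥ := fun h => hI (le_bot_iff.mp (h ▸ hIc))
      refine ⟨sSup c, ⟨hIc, fun h => ?_⟩, fun z hz => le_sSup hz⟩
      obtain ⟨J, hJ, hJ0, hJc, h2⟩ := (one_mem_finiteType_iff star h0).mp h
      obtain ⟨N, hN, hJN⟩ := (CompleteLattice.isCompactElement_iff_le_of_directed_sSup_le _ J).mp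
        ((Submodule.fg_iff_compact J).mp hJ) c ⟨y, hy⟩ hchain.directedOn hJc
      refine (hc hN).2 ((one_mem_finiteType_iff star ?_).mpr ⟨J, hJ, hJ0, hJN, h2⟩)
      exact fun h => hI (le_bot_iff.mp (h ▸ (hc hN).1))) I ⟨le_rfl, h1⟩
  have hM0 : M ≠ ⊥ := fun h => hI (le_bot_iff.mp (h ▸ hIM))
  have hne := coeSubmodule_ne_bot (L := L) hM0
  refine ⟨M, ⟨⟨?_, hM0, ?_⟩, ?_⟩, hIM⟩
  · rintro rfl
    refine hM.prop.2 (sf.le_self _ hne ?_)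
    rw [← map_one (algebraMap A L)]
    exact algebraMap_mem_coeSubmodule.mpr Submodule.mem_top
  · set J : Ideal A := (sf (IsLocalization.coeSubmodule L M)).comap (Algebra.linearMap A L) with hJ
    have hMJ : M ≤ J := fun x hx => sf.le_self _ hne (algebraMap_mem_coeSubmodule.mpr hx)
    refine le_antisymm (hM.le_of_ge ⟨hIM.trans hMJ, fun h => hM.prop.2 ?_⟩ hMJ) hMJ
    have hJ0 : J ≠ ⊥ := fun h => hM0 (le_bot_iff.mp (h ▸ hMJ))
    rw [← sf.idem _ hne]
    refine sf.mono _ _ (coeSubmodule_ne_bot hJ0) ?_ h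
    rintro _ ⟨x, hx, rfl⟩
    exact hx
  · rintro J ⟨hJtop, -, hJq⟩ hMJ
    refine hM.le_of_ge ⟨hIM.trans hMJ, fun h => hJtop ?_⟩ hMJ
    rw [Ideal.eq_top_iff_one, ← hJq]
    rwa [Submodule.mem_comap, Algebra.linearMap_apply, map_one]

/-- The primes contained in a quasi-`⋆_f`-maximal ideal, together with zero. -/
def tildePrimes (star : SemistarOperation A L) : Set (Ideal A) :=
  {P | P.IsPrime ∧ (P = ⊥ ∨ ∃ M, star.finiteType.IsQuasiMaximal M ∧ P ≤ M)}

theorem mem_tilde {E : Submodule A L} {x : L} :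
    x ∈ star.tilde E ↔
      ∀ M : Ideal A, star.finiteType.IsQuasiMaximal M → ∃ s : A, s ∉ M ∧ s • x ∈ E := by
  change x ∈ (⨅ P ∈ {P : PrimeSpectrum A | star.finiteType.IsQuasiMaximal P.asIdeal},
    localize E P) ↔ _
  simp only [Submodule.mem_iInf]
  exact ⟨fun h M hM => h ⟨M, hM.isPrime⟩ hM, fun h P hP => h P.asIdeal hP⟩

/-- The substance is `exists_fg`: a nonzero prime below no quasi-`⋆_f`-maximal ideal has `1` in its
`⋆_f`-closure, hence contains a finitely generated `J` with `1 ∈ J^⋆`, and no quasi-`⋆_f`-maximal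
ideal contains such a `J`. -/
theorem isControlledBy_tilde (star : SemistarOperation A L) :
    star.tilde.IsControlledBy star.tildePrimes where
  isPrime P hP := hP.1
  bot_mem := ⟨Ideal.isPrime_bot, Or.inl rfl⟩
  mem_of_le P hP Q hQ hle := by
    refine ⟨hQ, ?_⟩
    rcases hP.2 with rfl | ⟨M, hM, hPM⟩
    · exact Or.inl (le_bot_iff.mp hle)
    · exact Or.inr ⟨M, hM, hle.trans hPM⟩
  exists_fg P hP hPΔ := by
    have hP0 : P ≠ ⊥ := fun h => hPΔ ⟨hP, Or.inl h⟩
    have h1 : (1 : L) ∈ star.finiteType (IsLocalization.coeSubmodule L P) := by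
      by_contra h1
      exact hPΔ ⟨hP, Or.inr (exists_le_isQuasiMaximal star hP0 h1)⟩
    obtain ⟨J, hJ, hJ0, hJP, h1⟩ := (one_mem_finiteType_iff star hP0).mp h1
    refine ⟨J, hJ, hJP, fun Q hQ hle => ?_⟩
    rcases hQ.2 with rfl | ⟨M, hM, hQM⟩
    · exact hJ0 (le_bot_iff.mp hle)
    · refine hM.prop.1 ?_
      rw [Ideal.eq_top_iff_one, ← hM.prop.2.2]
      rw [Submodule.mem_comap, Algebra.linearMap_apply, map_one]
      exact (one_mem_finiteType_iff star hM.prop.2.1).mpr ⟨J, hJ, hJ0, hle.trans hQM, h1⟩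
  one_mem F _ hFΔ := mem_tilde.mpr fun M hM => by
    obtain ⟨s, hsF, hsM⟩ := Set.not_subset.mp (hFΔ M ⟨hM.isPrime, Or.inr ⟨M, hM, le_rfl⟩⟩)
    refine ⟨s, hsM, ?_⟩
    rw [Algebra.smul_def, mul_one]
    exact algebraMap_mem_coeSubmodule.mpr hsF
  mem_of_mem P hP hP0 x hx := by
    obtain ⟨M, hM, hPM⟩ := hP.2.resolve_left hP0
    obtain ⟨s, hsM, hs⟩ := mem_tilde.mp hx M hM
    rw [Algebra.smul_def, ← map_mul, algebraMap_mem_coeSubmodule] at hs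
    exact (hP.1.mem_or_mem hs).resolve_left fun h => hsM (hPM h)

/-- The localizations of a `⋆̃`-Noetherian domain at the quasi-`⋆̃`-primes are Noetherian. -/
theorem isNoetherianRing_localization_of_mem_tildePrimes
    (hN : star.tilde.IsNoetherianDomain) (P : Ideal A) [hP : P.IsPrime]
    (hPΔ : P ∈ star.tildePrimes) : IsNoetherianRing (Localization.AtPrime P) := by
  classical
  rcases hPΔ.2 with h0 | ⟨M, hM, hPM⟩
  · exact isNoetherianRing_localization_of_eq_bot P h0
  -- Denominators outside `M` lie outside `P`, hence are units in `A_P`.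
  have hquasi : ∀ J : Ideal (Localization.AtPrime P), J ≠ ⊥ →
      star.tilde.IsQuasiIdeal (J.under A) := by
    intro J hJ
    have hJ0 : J.under A ≠ ⊥ := fun h => hJ (by
      rw [← IsLocalization.map_under P.primeCompl _ J, h, Ideal.map_bot])
    refine ⟨hJ0, le_antisymm (fun x hx => ?_) fun x hx =>
      star.tilde.le_self _ (coeSubmodule_ne_bot hJ0) (algebraMap_mem_coeSubmodule.mpr hx)⟩
    obtain ⟨s, hsM, hs⟩ := mem_tilde.mp (Submodule.mem_comap.mp hx) M hM
    rw [Algebra.linearMap_apply, Algebra.smul_def, ← map_mul, algebraMap_mem_coeSubmodule,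
      Ideal.under, Ideal.mem_comap, map_mul] at hs
    exact (Ideal.unit_mul_mem_iff_mem J (IsLocalization.map_units _
      (⟨s, fun h => hsM (hPM h)⟩ : P.primeCompl))).mp hs
  have hwf : WellFoundedGT {I : Ideal A // star.tilde.IsQuasiIdeal I} := hN
  -- The zero ideal is not a quasi-ideal; `WithBot` supplies its value.
  let f : Ideal (Localization.AtPrime P) → WithBot {I : Ideal A // star.tilde.IsQuasiIdeal I} :=
    fun J => if h : J = ⊥ then ⊥ else ((⟨J.under A, hquasi J h⟩ : {I : Ideal A // _}) : WithBot _)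
  have hf : StrictMono f := by
    intro J J' hlt
    have hJ' : J' ≠ ⊥ := (bot_le.trans_lt hlt).ne'
    by_cases hJ : J = ⊥
    · simp only [f, dif_pos hJ, dif_neg hJ']
      exact WithBot.bot_lt_coe _
    · simp only [f, dif_neg hJ, dif_neg hJ']
      rw [WithBot.coe_lt_coe]
      refine lt_of_le_of_ne (Ideal.comap_mono hlt.le) fun h => hlt.ne ?_
      rw [← IsLocalization.map_under P.primeCompl _ J,
        ← IsLocalization.map_under P.primeCompl _ J', Subtype.mk.inj h]
  exact isNoetherianRing_iff.mpr ((isNoetherian_iff').mpr hf.wellFoundedGT)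

/-! ### The strong S-property and induction on the number of variables. -/

/-- Every prime below an element of `Δ` is in `Δ`, so adjacency in `QSpec ∪ {0}` is adjacency among
all primes. -/
theorem IsControlledBy.isStrongSDomain (h : star.IsControlledBy Δ)
    (H : ∀ Q₁ Q₂ : Ideal A, Q₁.IsPrime → Q₂ ∈ Δ → Q₁ ≤ Q₂ →
      (∀ q : Ideal A, q.IsPrime → Q₁ < q → ¬ q < Q₂) →
      ∀ q : Ideal A[X], q.IsPrime → Q₁.map (C : A →+* A[X]) < q →
        ¬ q < Q₂.map (C : A →+* A[X])) :
    star.IsStrongSDomain := by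
  intro P₁ P₂ hP
  have hX := h.polynomial (FractionRing A[X])
  have hmap0 : ∀ P : Ideal A, P ≠ ⊥ → P.map (C : A →+* A[X]) ≠ ⊥ := fun P hP0 h0 =>
    hP0 ((Ideal.map_eq_bot_iff_of_injective C_injective).mp h0)
  have hquasi : ∀ P : Ideal A, star.IsQuasiPrime P →
      (star.polynomial (FractionRing A[X])).IsQuasiPrime (P.map C) := by
    intro P hP
    have hprime := hP.1
    have hp : (P.map (C : A →+* A[X])).IsPrime := Ideal.isPrime_map_C_of_isPrime
    refine (hX.isQuasiPrime_iff hp (hmap0 P hP.2.1)).mpr ⟨hp, ?_⟩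
    rw [Ideal.comap_C_map_C]
    exact (h.isQuasiPrime_iff hP.1 hP.2.1).mp hP
  have hP₁ : P₁.IsPrime := by
    rcases hP.left with rfl | h1
    · exact Ideal.isPrime_bot
    · exact h1.1
  have hP₂ : P₂ ∈ Δ := (h.isQuasiPrime_iff hP.right.1 hP.right.2.1).mp hP.right
  refine ⟨hP.left.imp (fun h1 => by rw [h1, Ideal.map_bot]) (hquasi P₁), hquasi P₂ hP.right, ?_,
    fun q hq => ?_⟩
  · refine lt_of_le_of_ne (Ideal.map_mono hP.lt.le) fun heq => hP.lt.ne ?_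
    rw [← Ideal.comap_C_map_C P₁, heq, Ideal.comap_C_map_C]
  · refine H P₁ P₂ hP₁ hP₂ hP.lt.le (fun Q hQ h1 h2 => ?_) q hq.1
    exact hP.not_between Q ((h.isQuasiPrime_iff hQ (bot_le.trans_lt h1).ne').mpr
      (h.mem_of_le _ hP₂ Q hQ h2.le)) h1 h2

end Controlled

/-- If adjacent primes over `Δ` extend to adjacent primes in all finite type `D`-algebras, then
all iterated polynomial extensions are strong S-domains. -/
theorem isStrongSDomainAfter_of_isControlledBy {D : Type u} [CommRing D] (Δ : Set (Ideal D))
    (H : ∀ (A : Type u) [CommRing A] [Algebra D A] [Algebra.FiniteType D A] (Q₁ Q₂ : Ideal A)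
      [Q₁.IsPrime] [Q₂.IsPrime], Q₂.under D ∈ Δ → Q₁ ≤ Q₂ →
      (∀ q : Ideal A, q.IsPrime → Q₁ < q → ¬ q < Q₂) →
      ∀ q : Ideal A[X], q.IsPrime → Q₁.map (C : A →+* A[X]) < q →
        ¬ q < Q₂.map (C : A →+* A[X])) (n : ℕ) :
    ∀ (A L : Type u) [CommRing A] [IsDomain A] [Field L] [Algebra A L] [IsFractionRing A L]
      [Algebra D A] [Algebra.FiniteType D A] (star : SemistarOperation A L),
      star.IsControlledBy {Q : Ideal A | Q.IsPrime ∧ Q.under D ∈ Δ} →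
        IsStrongSDomainAfter n star := by
  induction n with
  | zero =>
    intro A L _ _ _ _ _ _ _ star h
    refine h.isStrongSDomain fun Q₁ Q₂ hQ₁ hQ₂ hle hadj => ?_
    have := hQ₂.1
    exact H A Q₁ Q₂ hQ₂.2 hle hadj
  | succ n ih =>
    intro A L _ _ _ _ _ _ _ star h
    have : Algebra.FiniteType D A[X] :=
      Algebra.FiniteType.trans (S := A) inferInstance inferInstance
    refine ih A[X] (FractionRing A[X]) _ ?_
    -- Contraction is transitive, so the controlling set on `A[X]` is again the set of all primes
    -- over `Δ`.
    have hX := h.polynomial (FractionRing A[X])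
    convert hX using 1
    ext Q
    exact ⟨fun hQ => ⟨hQ.1, haveI := hQ.1; Ideal.comap_isPrime C Q, hQ.2⟩,
      fun hQ => ⟨hQ.1, hQ.2.2⟩⟩

end SemistarOperation

theorem corollary2p6 {D K : Type u} [CommRing D] [IsDomain D] [Field K] [Algebra D K]
    [IsFractionRing D K] (star : SemistarOperation D K) :
    (star.tilde.IsNoetherianDomain → star.tilde.IsStablyStrongSDomain) ∧
      (star.tilde.IsQuasiPruferDomain → star.tilde.IsStablyStrongSDomain) := by
  have hctrl : star.tilde.IsControlledBy
      {Q : Ideal D | Q.IsPrime ∧ Q.under D ∈ star.tildePrimes} := by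
    convert star.isControlledBy_tilde using 1
    ext Q
    exact ⟨fun hQ => hQ.2, fun hQ => ⟨hQ.1, hQ⟩⟩
  constructor
  · intro hN n _
    refine SemistarOperation.isStrongSDomainAfter_of_isControlledBy
      star.tildePrimes ?_ n D K _ hctrl
    intro A _ _ _ Q₁ Q₂ _ _ hQ₂ hle hadj
    exact not_between_map_C_of_isNoetherianRing (D := D) hle hadj
      (SemistarOperation.isNoetherianRing_localization_of_mem_tildePrimes hN _ hQ₂)
  · intro hQP n _
    refine SemistarOperation.isStrongSDomainAfter_of_isControlledBy
      star.tildePrimes ?_ n D K _ hctrl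
    intro A _ _ _ Q₁ Q₂ _ _ hQ₂ hle hadj
    refine not_between_map_C_of_extended (D := D) hle hadj fun Q hQ hQle => ?_
    -- Zero is not a quasi-prime, so the quasi-Prüfer hypothesis does not reach this case; here `Q =
    -- 0`.
    by_cases h0 : Q₂.under D = ⊥
    · rw [h0, Ideal.map_bot, le_bot_iff] at hQle
      rw [hQle, Ideal.comap_bot_of_injective _ C_injective, Ideal.map_bot]
    · exact hQP Q hQ _ ((star.isControlledBy_tilde.isQuasiPrime_iff hQ₂.1 h0).mpr hQ₂) hQle
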